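/- Let $(\mathcal X,F)$ be a Finsler manifold: an $n$-dimensional manifold without boundary together with a norm $F_x$ on every tangent space $T_x\mathcal X$ which is continuous as a function on the tangent bundle, equipped with the metric $d(x,y)=\inf_\gamma\int_0^1 F_{\gamma(t)}(\gamma'(t))\,dt$, the infimum over all $C^1$ paths from $x$ to $y$. Suppose that $\mathcal X$ is not Riemannian, i.e. there is no continuous Riemannian metric $g$ on $\mathcal X$ with $F_x(v)^2=g_x(v,v)$ for all $x\in\mathcal X$ and $v\in T_x\mathcal X$. Let $\mathbb R^{p,q}=\mathbb R^p\times\mathbb R^q$ be Minkowski space, with quadratic form $\langle z,z\rangle=|\pi^+z|^2-|\pi^-z|^2$, where $\pi^+$ and $\pi^-$ are the projections onto $\mathbb R^{p,0}=\mathbb R^p$ and $\mathbb R^{0,q}=\mathbb R^q$ and $|\cdot|$ is the Euclidean norm. Suppose that there is a path isometric embedding $f:\mathcal X\to\mathbb R^{p,q}$, i.e. a topological embedding which preserves the energy of paths: for every Lipschitz path $\alpha:[a,b]\to\mathcal X$ with $a<b$, $$\lim_{N\to\infty}\sum_{k=1}^N\frac{\langle f(\alpha(t_k))-f(\alpha(t_{k-1})),\,f(\alpha(t_k))-f(\alpha(t_{k-1}))\rangle}{t_k-t_{k-1}}=E(\alpha),\qquad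 t_k=a+k\,\frac{b-a}{N},$$ where $$E(\alpha)=\sup_{a=s_0<s_1<\dots<s_m=b}\ \sum_{k=1}^m\frac{d(\alpha(s_{k-1}),\alpha(s_k))^2}{s_k-s_{k-1}}$$ is the energy of $\alpha$ in the metric space $\mathcal X$. Then $p>0$ and $q>0$, and neither $\pi^+\circ f$ nor $\pi^-\circ f$ is locally Lipschitz (as maps from $(\mathcal X,d)$ to Euclidean space). -/

import Mathlib

open Set Filter Topology
open scoped Manifold ENNReal NNReal ContDiff Bundle

noncomputable section

/-- A Finsler structure on an `n`-dimensional manifold `M`: a norm on every tangent space, which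
is continuous as a function on the tangent bundle. -/
structure FinslerStructure (n : ℕ) (M : Type*) [TopologicalSpace M]
    [ChartedSpace (EuclideanSpace ℝ (Fin n)) M] [IsManifold (𝓡 n) 1 M] where
  /-- the norm on the tangent space at `x` (a seminorm which is positive by `pos`) -/
  norm : ∀ x : M, Seminorm ℝ (TangentSpace (𝓡 n) x)
  pos : ∀ (x : M) (v : TangentSpace (𝓡 n) x), v ≠ 0 → 0 < norm x v
  continuous : Continuous (fun w : TangentBundle (𝓡 n) M => norm w.proj w.snd)

namespace FinslerStructure

variable {n : ℕ} {M : Type*} [TopologicalSpace M]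
  [ChartedSpace (EuclideanSpace ℝ (Fin n)) M] [IsManifold (𝓡 n) 1 M]

/-- The Finsler distance of two points: the infimum of `∫ F(γ(t), γ'(t)) dt` over all `C^1` paths
`γ : [0, 1] → M` from `x` to `y` (and `∞` if there is none). Mathlib's `Manifold.riemannianEDist`
is this infimum for an arbitrary family of norms on the tangent spaces. -/
def finslerEDist (F : FinslerStructure n M) (x y : M) : ℝ≥0∞ :=
  letI : ∀ z : M, ENorm (TangentSpace (𝓡 n) z) :=
    fun z => ⟨fun v => ENNReal.ofReal (F.norm z v)⟩
  Manifold.riemannianEDist (𝓡 n) x y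

/-- A Finsler structure is Riemannian if its norms are the norms of a (continuous) Riemannian
metric `g`, that is, `F(x, v)² = g_x(v, v)`. -/
def IsRiemannian (F : FinslerStructure n M) : Prop :=
  ∃ g : Bundle.ContinuousRiemannianMetric (EuclideanSpace ℝ (Fin n))
      (fun x : M => TangentSpace (𝓡 n) x),
    ∀ (x : M) (v : TangentSpace (𝓡 n) x), F.norm x v ^ 2 = g.inner x v v

end FinslerStructure

/-- The energy of a path `α : [a, b] → X` in a metric space: the supremum of
`∑ d(α(t_{k-1}), α(t_k))² / (t_k - t_{k-1})` over all subdivisions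
`a = t_0 < t_1 < ⋯ < t_m = b`. -/
def pathEnergy {X : Type*} [PseudoEMetricSpace X] (α : ℝ → X) (a b : ℝ) : ℝ≥0∞ :=
  ⨆ (m : ℕ) (t : ℕ → ℝ) (_ : t 0 = a) (_ : t m = b) (_ : ∀ k < m, t k < t (k + 1)),
    ∑ k ∈ Finset.range m,
      edist (α (t k)) (α (t (k + 1))) ^ 2 / ENNReal.ofReal (t (k + 1) - t k)

/-- Minkowski space `ℝ^{p,q}`, as the topological vector space `ℝ^p × ℝ^q`. -/
abbrev MinkowskiSpace (p q : ℕ) : Type :=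
  EuclideanSpace ℝ (Fin p) × EuclideanSpace ℝ (Fin q)

namespace MinkowskiSpace

variable {p q : ℕ}

/-- The quadratic form `⟨z, z⟩ = z₁² + ⋯ + z_p² - z_{p+1}² - ⋯ - z_{p+q}²`. -/
def quadForm (z : MinkowskiSpace p q) : ℝ := ‖z.1‖ ^ 2 - ‖z.2‖ ^ 2

/-- The projection onto the positive factor `ℝ^{p,0}`. -/
def posProj (z : MinkowskiSpace p q) : EuclideanSpace ℝ (Fin p) := z.1

/-- The projection onto the negative factor `ℝ^{0,q}`. -/
def negProj (z : MinkowskiSpace p q) : EuclideanSpace ℝ (Fin q) := z.2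

/-- The energy sum `∑_{k=1}^{N} ⟨β(t_k) - β(t_{k-1}), β(t_k) - β(t_{k-1})⟩ / (t_k - t_{k-1})` of
the subdivision of `[a, b]` into `N` intervals of equal length. -/
def energySum (β : ℝ → MinkowskiSpace p q) (a b : ℝ) (N : ℕ) : ℝ :=
  ∑ k ∈ Finset.range N,
    quadForm (β (a + (k + 1) * ((b - a) / N)) - β (a + k * ((b - a) / N))) / ((b - a) / N)

/-- The path `β : [a, b] → ℝ^{p,q}` has energy `e`: its energy sums converge to `e`. -/
def HasEnergy (β : ℝ → MinkowskiSpace p q) (a b e : ℝ) : Prop :=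
  Tendsto (energySum β a b) atTop (𝓝 e)

end MinkowskiSpace

/-- A path isometry into Minkowski space: every Lipschitz path `α : [a, b] → X` (a path of finite
energy) is mapped to a path which has an energy, equal to the energy of `α`. -/
def IsPathIsometry {X : Type*} [PseudoEMetricSpace X] {p q : ℕ}
    (f : X → MinkowskiSpace p q) : Prop :=
  ∀ (α : ℝ → X) (a b : ℝ), a < b → (∃ K : ℝ≥0, LipschitzOnWith K α (Icc a b)) →
    MinkowskiSpace.HasEnergy (f ∘ α) a b (pathEnergy α a b).toReal

end

/-! Suppose that one projection of `f` is locally Lipschitz; then `F` is Riemannian. The energy sums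
of a path in `ℝ^{p,q}` are the sums of its positive part minus those of its negative part. Along a
Lipschitz path the sums of the Lipschitz projection are bounded and the difference converges to the
known energy, so the sums of the other projection are bounded too. Cauchy–Schwarz then bounds its
increment, and `f` is Lipschitz in charts (`exists_lipschitzOnWith_ball`).

The energy density of `f` along a chart line of direction `v` is now computed twice. In `M` it is
`F(v)²`, because near a point the Finsler distance is, up to a factor close to `1`, the norm at that
point (`tendsto_pathEnergy_line_div`). In Minkowski space it is the quadratic form of the velocity
almost everywhere, by Rademacher and Lebesgue differentiation (`ae_eq_quadForm_deriv`). By Fubini,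
for each fixed `v` the identity `F_y(v)² = ⟨Df_y v, Df_y v⟩` holds for almost every `y`
(`ae_eq_quadForm_fderiv`).

Hence each linearity relation for the polarization of `F_y²` holds for almost every `y`. It involves
only continuous functions of `y`, so it holds everywhere (`isQuadratic_norm`), and the polarization
is a continuous Riemannian metric. If `p = 0` or `q = 0`, one projection is constant, hence
Lipschitz. -/

/-! ### Finsler norms in a trivialization -/

/-- A family of seminorms which is jointly continuous at a norm is, near this norm, uniformly
comparable to it with any constant `C > 1`. -/
theorem Seminorm.eventually_le_mul {X E : Type*} [TopologicalSpace X] [NormedAddCommGroup E]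
    [NormedSpace ℝ E] [FiniteDimensional ℝ E] (N : X → Seminorm ℝ E) {x₀ : X}
    (hpos : ∀ v, v ≠ 0 → 0 < N x₀ v)
    (hcont : ∀ v, ContinuousAt (fun z : X × E => N z.1 z.2) (x₀, v)) {C : ℝ} (hC : 1 < C) :
    ∀ᶠ x in 𝓝 x₀, ∀ v, N x v ≤ C * N x₀ v ∧ N x₀ v ≤ C * N x v := by
  have hcont' : ∀ v, ContinuousAt (fun z : X × E => N x₀ z.2) (x₀, v) := fun v =>
    ContinuousAt.comp (x := ((x₀, v) : X × E)) (f := fun z : X × E => ((x₀, z.2) : X × E))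
      (g := fun z : X × E => N z.1 z.2) (hcont v) (continuousAt_const.prodMk continuousAt_snd)
  -- The inequalities are strict at `x₀` on the unit sphere, so compactness gives one neighbourhood
  -- for all unit vectors; homogeneity does the rest.
  have key : ∀ᶠ x in 𝓝 x₀, ∀ v ∈ Metric.sphere (0 : E) 1,
      N x v < C * N x₀ v ∧ N x₀ v < C * N x v := by
    refine IsCompact.eventually_forall_of_forall_eventually
      (P := fun x v => N x v < C * N x₀ v ∧ N x₀ v < C * N x v) (isCompact_sphere 0 1) ?_
    intro v hv
    have hv0 : v ≠ 0 := ne_zero_of_mem_unit_sphere ⟨v, hv⟩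
    have hlt : N x₀ v < C * N x₀ v := by nlinarith [hpos v hv0]
    exact ((hcont v).eventually_lt ((hcont' v).const_mul C) hlt).and
      ((hcont' v).eventually_lt ((hcont v).const_mul C) hlt)
  filter_upwards [key] with x hx v
  rcases eq_or_ne v 0 with rfl | hv
  · simp
  have hnv : 0 < ‖v‖ := norm_pos_iff.2 hv
  have hdec : v = ‖v‖ • (‖v‖⁻¹ • v) := by rw [smul_smul, mul_inv_cancel₀ hnv.ne', one_smul]
  have hsph : ‖v‖⁻¹ • v ∈ Metric.sphere (0 : E) 1 := by
    simp [norm_smul, hnv.ne']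
  have h := hx _ hsph
  have hmul : ∀ y, N y v = ‖v‖ * N y (‖v‖⁻¹ • v) := fun y => by
    conv_lhs => rw [hdec, map_smul_eq_mul, norm_norm]
  rw [hmul x, hmul x₀]
  constructor <;> nlinarith

namespace FinslerStructure

variable {n : ℕ} {M : Type*} [TopologicalSpace M]
  [ChartedSpace (EuclideanSpace ℝ (Fin n)) M] [IsManifold (𝓡 n) 1 M]

/-- The Finsler norm at `b`, read in the trivialization of the tangent bundle at `x₀`. -/
noncomputable def localNorm (F : FinslerStructure n M) (x₀ b : M) :
    Seminorm ℝ (EuclideanSpace ℝ (Fin n)) :=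
  (F.norm b).comp ((trivializationAt (EuclideanSpace ℝ (Fin n))
    (TangentSpace (𝓡 n) : M → Type _) x₀).symmL ℝ b).toLinearMap

theorem localNorm_apply (F : FinslerStructure n M) (x₀ b : M) (v : EuclideanSpace ℝ (Fin n)) :
    F.localNorm x₀ b v = F.norm b ((trivializationAt (EuclideanSpace ℝ (Fin n))
      (TangentSpace (𝓡 n) : M → Type _) x₀).symmL ℝ b v) := rfl

theorem localNorm_continuousLinearMapAt (F : FinslerStructure n M) {x₀ b : M}
    (hb : b ∈ (chartAt (EuclideanSpace ℝ (Fin n)) x₀).source) (v : TangentSpace (𝓡 n) b) :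
    F.localNorm x₀ b ((trivializationAt (EuclideanSpace ℝ (Fin n))
      (TangentSpace (𝓡 n) : M → Type _) x₀).continuousLinearMapAt ℝ b v) = F.norm b v := by
  rw [localNorm_apply, Bundle.Trivialization.symmL_continuousLinearMapAt]
  simpa using hb

theorem localNorm_pos (F : FinslerStructure n M) {x₀ b : M}
    (hb : b ∈ (chartAt (EuclideanSpace ℝ (Fin n)) x₀).source)
    {v : EuclideanSpace ℝ (Fin n)} (hv : v ≠ 0) : 0 < F.localNorm x₀ b v := by
  rw [localNorm_apply]
  refine F.pos _ _ fun h => hv ?_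
  have hb' : b ∈ (trivializationAt (EuclideanSpace ℝ (Fin n))
      (TangentSpace (𝓡 n) : M → Type _) x₀).baseSet := by simpa using hb
  rw [← Bundle.Trivialization.continuousLinearMapAt_symmL (R := ℝ) _ hb' v, h, map_zero]

theorem continuousOn_localNorm (F : FinslerStructure n M) (x₀ : M) :
    ContinuousOn (fun z : M × EuclideanSpace ℝ (Fin n) => F.localNorm x₀ z.1 z.2)
      ((chartAt (EuclideanSpace ℝ (Fin n)) x₀).source ×ˢ univ) := by
  have h := F.continuous.comp_continuousOn (Bundle.Trivialization.continuousOn_symm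
    (trivializationAt (EuclideanSpace ℝ (Fin n)) (TangentSpace (𝓡 n) : M → Type _) x₀))
  rw [TangentBundle.trivializationAt_baseSet] at h
  refine h.congr fun z hz => ?_
  rw [localNorm_apply, Bundle.Trivialization.symmL_apply _ (by simpa using hz.1)]
  rfl

theorem continuousAt_localNorm (F : FinslerStructure n M) {x₀ b : M}
    (hb : b ∈ (chartAt (EuclideanSpace ℝ (Fin n)) x₀).source) (v : EuclideanSpace ℝ (Fin n)) :
    ContinuousAt (fun z : M × EuclideanSpace ℝ (Fin n) => F.localNorm x₀ z.1 z.2) (b, v) :=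
  (F.continuousOn_localNorm x₀).continuousAt
    (prod_mem_nhds ((chartAt _ x₀).open_source.mem_nhds hb) univ_mem)

theorem eventually_localNorm_le_mul (F : FinslerStructure n M) {x₀ b₀ : M}
    (hb : b₀ ∈ (chartAt (EuclideanSpace ℝ (Fin n)) x₀).source) {C : ℝ} (hC : 1 < C) :
    ∀ᶠ b in 𝓝 b₀, ∀ v, F.localNorm x₀ b v ≤ C * F.localNorm x₀ b₀ v ∧
      F.localNorm x₀ b₀ v ≤ C * F.localNorm x₀ b v :=
  Seminorm.eventually_le_mul (F.localNorm x₀) (fun _ => F.localNorm_pos hb)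
    (F.continuousAt_localNorm hb) hC

end FinslerStructure

/-! ### Comparison of the Finsler distance with a fixed norm -/

namespace FinslerStructure

variable {n : ℕ} {M : Type*} [TopologicalSpace M]
  [ChartedSpace (EuclideanSpace ℝ (Fin n)) M] [IsManifold (𝓡 n) 1 M]

/-- The inverse trivialization is the derivative of the inverse chart, so speeds of chart segments
are local norms. -/
theorem norm_mfderivWithin_extChartAt_symm (F : FinslerStructure n M) {x₀ : M}
    {y : EuclideanSpace ℝ (Fin n)} (hy : y ∈ (extChartAt (𝓡 n) x₀).target)
    (v : EuclideanSpace ℝ (Fin n)) :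
    F.norm ((extChartAt (𝓡 n) x₀).symm y)
      (mfderivWithin 𝓘(ℝ, EuclideanSpace ℝ (Fin n)) (𝓡 n)
        (extChartAt (𝓡 n) x₀).symm (range (𝓡 n)) y v) =
      F.localNorm x₀ ((extChartAt (𝓡 n) x₀).symm y) v := by
  have hb : (extChartAt (𝓡 n) x₀).symm y ∈ (chartAt (EuclideanSpace ℝ (Fin n)) x₀).source := by
    rw [← extChartAt_source (𝓡 n)]
    exact (extChartAt (𝓡 n) x₀).map_target hy
  -- The base point `extChartAt x₀ (symm y)` equals `y` only propositionally and the type of the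
  -- derivative depends on it, so the equality is stated in the model space.
  have key : ∀ y', y' = y →
      (mfderivWithin 𝓘(ℝ, EuclideanSpace ℝ (Fin n)) (𝓡 n)
        (extChartAt (𝓡 n) x₀).symm (range (𝓡 n)) y' v : EuclideanSpace ℝ (Fin n)) =
      mfderivWithin 𝓘(ℝ, EuclideanSpace ℝ (Fin n)) (𝓡 n)
        (extChartAt (𝓡 n) x₀).symm (range (𝓡 n)) y v := by
    rintro y' rfl; rfl
  rw [localNorm_apply, TangentBundle.symmL_trivializationAt hb]
  exact congrArg (fun w : EuclideanSpace ℝ (Fin n) => F.norm ((extChartAt (𝓡 n) x₀).symm y) w)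
    (key _ ((extChartAt (𝓡 n) x₀).right_inv hy)).symm

/-- The extended norm on the tangent spaces given by a Finsler structure. -/
@[reducible] noncomputable def tangentENorm (F : FinslerStructure n M) (z : M) :
    ENorm (TangentSpace (𝓡 n) z) :=
  ⟨fun v => ENNReal.ofReal (F.norm z v)⟩

/-- The distance is an infimum over paths on `[0, 1]`; homogeneity of `F` makes length invariant
under the rescaling from `[a, b]`. -/
theorem finslerEDist_le_pathELength (F : FinslerStructure n M) {γ : ℝ → M} {a b : ℝ}
    (hγ : ContMDiffOn 𝓘(ℝ, ℝ) (𝓡 n) 1 γ (Icc a b)) (hab : a ≤ b) :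
    F.finslerEDist (γ a) (γ b) ≤
      (letI := F.tangentENorm; Manifold.pathELength (𝓡 n) γ a b) := by
  let := F.tangentENorm
  have : ∀ z : M, ENormSMulClass ℝ (TangentSpace (𝓡 n) z) := fun z =>
    ⟨fun c v => by
      change ENNReal.ofReal _ = _ * ENNReal.ofReal _
      rw [map_smul_eq_mul, ENNReal.ofReal_mul (norm_nonneg _), ofReal_norm]⟩
  exact Manifold.riemannianEDist_le_pathELength hγ rfl rfl hab

theorem exists_pathELength_lt (F : FinslerStructure n M) {x y : M} {r : ℝ≥0∞}
    (hr : F.finslerEDist x y < r) :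
    ∃ γ : ℝ → M, γ 0 = x ∧ γ 1 = y ∧ ContMDiffOn 𝓘(ℝ, ℝ) (𝓡 n) 1 γ (Icc 0 1) ∧
      (letI := F.tangentENorm; Manifold.pathELength (𝓡 n) γ 0 1) < r := by
  let := F.tangentENorm
  exact Manifold.exists_lt_of_riemannianEDist_lt hr

/-- The Finsler distance is bounded by the length of a segment in a chart. -/
theorem finslerEDist_le_of_segment (F : FinslerStructure n M) {x₀ : M}
    {y z : EuclideanSpace ℝ (Fin n)} (hs : segment ℝ y z ⊆ (extChartAt (𝓡 n) x₀).target) {c : ℝ}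
    (hc : ∀ w ∈ segment ℝ y z, F.localNorm x₀ ((extChartAt (𝓡 n) x₀).symm w) (z - y) ≤ c) :
    F.finslerEDist ((extChartAt (𝓡 n) x₀).symm y) ((extChartAt (𝓡 n) x₀).symm z) ≤
      ENNReal.ofReal c := by
  let η := ContinuousAffineMap.lineMap (R := ℝ) y z
  have hη : Icc (0 : ℝ) 1 ⊆ η ⁻¹' segment ℝ y z := by
    rw [← image_subset_iff, ContinuousAffineMap.coe_lineMap_eq, ← segment_eq_image_lineMap]
  have hηt : Icc (0 : ℝ) 1 ⊆ η ⁻¹' (extChartAt (𝓡 n) x₀).target :=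
    hη.trans (preimage_mono hs)
  have η_smooth : ContMDiffOn 𝓘(ℝ, ℝ) 𝓘(ℝ, EuclideanSpace ℝ (Fin n)) 1 η (Icc 0 1) := by
    apply ContMDiff.contMDiffOn
    rw [contMDiff_iff_contDiff]
    exact ContinuousAffineMap.contDiff _
  have hle := F.finslerEDist_le_pathELength (γ := (extChartAt (𝓡 n) x₀).symm ∘ η)
    ((contMDiffOn_extChartAt_symm x₀).comp η_smooth hηt) zero_le_one
  rw [Function.comp_apply, Function.comp_apply, show η 0 = y by
    simp [η, ContinuousAffineMap.coe_lineMap_eq], show η 1 = z by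
    simp [η, ContinuousAffineMap.coe_lineMap_eq]] at hle
  refine hle.trans ?_
  let := F.tangentENorm
  rw [Manifold.pathELength_eq_lintegral_mfderivWithin_Icc]
  have hbound : ∀ t ∈ Icc (0 : ℝ) 1,
      ‖mfderivWithin 𝓘(ℝ, ℝ) (𝓡 n) ((extChartAt (𝓡 n) x₀).symm ∘ η) (Icc 0 1) t 1‖ₑ ≤
        ENNReal.ofReal c := by
    intro t ht
    have h1 : mfderivWithin 𝓘(ℝ, ℝ) (𝓡 n) ((extChartAt (𝓡 n) x₀).symm ∘ η) (Icc 0 1) t =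
        (mfderivWithin 𝓘(ℝ, EuclideanSpace ℝ (Fin n)) (𝓡 n)
          (extChartAt (𝓡 n) x₀).symm (range (𝓡 n)) (η t)) ∘L
        (mfderivWithin 𝓘(ℝ, ℝ) 𝓘(ℝ, EuclideanSpace ℝ (Fin n)) η (Icc 0 1) t) := by
      apply mfderivWithin_comp
      · exact mdifferentiableWithinAt_extChartAt_symm (hηt ht)
      · exact η_smooth.mdifferentiableOn one_ne_zero t ht
      · exact hηt.trans (preimage_mono (extChartAt_target_subset_range x₀))
      · rw [uniqueMDiffWithinAt_iff_uniqueDiffWithinAt]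
        exact uniqueDiffOn_Icc zero_lt_one t ht
    have h2 : (mfderivWithin 𝓘(ℝ, ℝ) 𝓘(ℝ, EuclideanSpace ℝ (Fin n)) η (Icc 0 1) t 1 :
        EuclideanSpace ℝ (Fin n)) = z - y := by
      rw [mfderivWithin_eq_fderivWithin,
        fderivWithin_eq_fderiv (uniqueDiffOn_Icc zero_lt_one _ ht)
          (ContinuousAffineMap.differentiableAt _)]
      exact show fderiv ℝ (ContinuousAffineMap.lineMap (R := ℝ) y z) t 1 = z - y by simp
    rw [h1]
    refine ENNReal.ofReal_le_ofReal ?_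
    refine le_trans (le_of_eq ?_) (hc (η t) (hη ht))
    rw [← F.norm_mfderivWithin_extChartAt_symm (hηt ht), ← h2]
    rfl
  calc _ ≤ ∫⁻ _ in Icc (0 : ℝ) 1, ENNReal.ofReal c :=
        MeasureTheory.setLIntegral_mono' measurableSet_Icc hbound
    _ = ENNReal.ofReal c := by simp

end FinslerStructure

/-- A seminorm is attained at a given vector by a linear functional which it dominates. -/
theorem Seminorm.exists_linearMap_eq_of_le {E : Type*} [AddCommGroup E] [Module ℝ E]
    (p : Seminorm ℝ E) (x : E) : ∃ l : E →ₗ[ℝ] ℝ, l x = p x ∧ ∀ y, |l y| ≤ p y := by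
  -- This makes `c • x ↦ c * p x` well defined on the span of `x`, also for `x = 0`; Hahn–Banach
  -- extends it.
  have H : ∀ c : ℝ, c • x = 0 → c • p x = 0 := fun c hc => by
    have h : |c| * p x = 0 := by
      rw [← Real.norm_eq_abs, ← map_smul_eq_mul, hc, map_zero]
    rcases mul_eq_zero.1 h with h | h
    · simp [abs_eq_zero.1 h]
    · simp [h]
  obtain ⟨l, hl, hle⟩ := exists_extension_of_le_sublinear (LinearPMap.mkSpanSingleton' x (p x) H) p
    (fun c hc y => by rw [map_smul_eq_mul, Real.norm_of_nonneg hc.le]) (map_add_le_add p) (by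
      rintro ⟨y, hy⟩
      rw [LinearPMap.domain_mkSpanSingleton, Submodule.mem_span_singleton] at hy
      obtain ⟨c, rfl⟩ := hy
      rw [LinearPMap.mkSpanSingleton'_apply, map_smul_eq_mul]
      exact mul_le_mul_of_nonneg_right (le_abs_self c) (apply_nonneg p x))
  refine ⟨l, ?_, fun y => abs_le'.2 ⟨hle y, ?_⟩⟩
  · rw [hl ⟨x, by
      rw [LinearPMap.domain_mkSpanSingleton]; exact Submodule.mem_span_singleton_self x⟩]
    exact LinearPMap.mkSpanSingleton'_apply_self x (p x) H _
  · rw [← map_neg, ← map_neg_eq_map p]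
    exact hle (-y)

namespace FinslerStructure

section

variable {n : ℕ} {M : Type*} [TopologicalSpace M]
  [ChartedSpace (EuclideanSpace ℝ (Fin n)) M] [IsManifold (𝓡 n) 1 M]

/-- The length of a path in a chart bounds the increment of each linear functional which is
dominated by the norm. -/
theorem ofReal_abs_sub_le_pathELength (F : FinslerStructure n M) {x₀ : M} {γ : ℝ → M}
    (hγ : ContMDiffOn 𝓘(ℝ, ℝ) (𝓡 n) 1 γ (Icc 0 1))
    (hs : ∀ t ∈ Icc (0 : ℝ) 1, γ t ∈ (chartAt (EuclideanSpace ℝ (Fin n)) x₀).source)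
    (l : EuclideanSpace ℝ (Fin n) →L[ℝ] ℝ) {C : ℝ} (hC : 0 ≤ C)
    (hl : ∀ t ∈ Icc (0 : ℝ) 1, ∀ w, |l w| ≤ C * F.localNorm x₀ (γ t) w) :
    ENNReal.ofReal |l (extChartAt (𝓡 n) x₀ (γ 1) - extChartAt (𝓡 n) x₀ (γ 0))| ≤
      ENNReal.ofReal C * (letI := F.tangentENorm; Manifold.pathELength (𝓡 n) γ 0 1) := by
  let := F.tangentENorm
  let c := extChartAt (𝓡 n) x₀ ∘ γ
  have hc : ContMDiffOn 𝓘(ℝ, ℝ) 𝓘(ℝ, EuclideanSpace ℝ (Fin n)) 1 c (Icc 0 1) :=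
    contMDiffOn_extChartAt.comp (I' := 𝓡 n)
      (t := (chartAt (EuclideanSpace ℝ (Fin n)) x₀).source) hγ hs
  rw [contMDiffOn_iff_contDiffOn] at hc
  have hlc : ContDiffOn ℝ 1 (l ∘ c) (Icc 0 1) := l.contDiff.comp_contDiffOn hc
  have h1 := enorm_sub_le_lintegral_derivWithin_Icc_of_contDiffOn_Icc hlc zero_le_one
  rw [map_sub, ← Real.enorm_eq_ofReal_abs]
  refine h1.trans ?_
  rw [Manifold.pathELength_eq_lintegral_mfderivWithin_Icc,
    ← MeasureTheory.lintegral_const_mul' _ _ ENNReal.ofReal_ne_top]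
  refine MeasureTheory.setLIntegral_mono' measurableSet_Icc fun t ht => ?_
  have hu := uniqueDiffOn_Icc (zero_lt_one (α := ℝ)) t ht
  have h2 : derivWithin (l ∘ c) (Icc 0 1) t = l (derivWithin c (Icc 0 1) t) :=
    ((l.hasFDerivAt).comp_hasDerivWithinAt t
      ((hc.differentiableOn one_ne_zero) t ht).hasDerivWithinAt).derivWithin hu
  have h3 : mfderivWithin 𝓘(ℝ, ℝ) 𝓘(ℝ, EuclideanSpace ℝ (Fin n)) c (Icc 0 1) t =
      (mfderiv (𝓡 n) 𝓘(ℝ, EuclideanSpace ℝ (Fin n)) (extChartAt (𝓡 n) x₀) (γ t)) ∘L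
        (mfderivWithin 𝓘(ℝ, ℝ) (𝓡 n) γ (Icc 0 1) t) := by
    apply mfderiv_comp_mfderivWithin
    · exact mdifferentiableAt_extChartAt (hs t ht)
    · exact hγ.mdifferentiableOn one_ne_zero t ht
    · rw [uniqueMDiffWithinAt_iff_uniqueDiffWithinAt]
      exact hu
  have h4 : derivWithin c (Icc 0 1) t =
      (trivializationAt (EuclideanSpace ℝ (Fin n)) (TangentSpace (𝓡 n) : M → Type _)
        x₀).continuousLinearMapAt ℝ (γ t) (mfderivWithin 𝓘(ℝ, ℝ) (𝓡 n) γ (Icc 0 1) t 1) := by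
    rw [TangentBundle.continuousLinearMapAt_trivializationAt (hs t ht),
      ← fderivWithin_derivWithin, ← mfderivWithin_eq_fderivWithin, h3]
    rfl
  rw [h2, Real.enorm_eq_ofReal_abs]
  change _ ≤ ENNReal.ofReal C * ENNReal.ofReal (F.norm (γ t) _)
  rw [← ENNReal.ofReal_mul hC, ← F.localNorm_continuousLinearMapAt (hs t ht), ← h4]
  exact ENNReal.ofReal_le_ofReal (hl t ht _)

end

variable {n : ℕ} {M : Type*} [EMetricSpace M]
  [ChartedSpace (EuclideanSpace ℝ (Fin n)) M] [IsManifold (𝓡 n) 1 M]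

/-- Near `b₀`, the norm at `b₀` of the increment in a chart is at most `C` times the Finsler
distance, for any `C > 1`. -/
theorem exists_eball_localNorm_le_edist (F : FinslerStructure n M)
    (hdist : ∀ x y : M, edist x y = F.finslerEDist x y) {x₀ b₀ : M}
    (hb : b₀ ∈ (chartAt (EuclideanSpace ℝ (Fin n)) x₀).source) {C : ℝ} (hC : 1 < C) :
    ∃ r > 0, ∀ b ∈ Metric.eball b₀ r, ∀ b' ∈ Metric.eball b₀ r,
      ENNReal.ofReal (F.localNorm x₀ b₀ (extChartAt (𝓡 n) x₀ b' - extChartAt (𝓡 n) x₀ b)) ≤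
        ENNReal.ofReal C * edist b b' := by
  obtain ⟨R, hR, hsub⟩ := Metric.nhds_basis_eball.mem_iff.1
    ((F.eventually_localNorm_le_mul hb hC).and ((chartAt _ x₀).open_source.mem_nhds hb))
  -- Two points of the ball of radius `R / 3` are less than `2R / 3` apart, and a path shorter than
  -- that starting in this ball stays in the ball of radius `R`.
  refine ⟨R / 3, ENNReal.div_pos hR.ne' (by simp), fun b hbr b' hbr' => ?_⟩
  have hbb' : edist b b' < R / 3 + R / 3 :=
    (edist_triangle_right b b' b₀).trans_lt (ENNReal.add_lt_add hbr hbr')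
  have hR3 : R / 3 + (R / 3 + R / 3) = R := by
    rw [← add_assoc]; exact ENNReal.add_thirds R
  -- A norming functional of the increment: it is dominated by the norm at `b₀`, hence by `C` times
  -- the norm at each point of the path, so scalar integration suffices.
  obtain ⟨l, hlx, hl⟩ := (F.localNorm x₀ b₀).exists_linearMap_eq_of_le
    (extChartAt (𝓡 n) x₀ b' - extChartAt (𝓡 n) x₀ b)
  have hkey : ∀ L, edist b b' < L → L < R / 3 + R / 3 →
      ENNReal.ofReal (F.localNorm x₀ b₀ (extChartAt (𝓡 n) x₀ b' - extChartAt (𝓡 n) x₀ b)) ≤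
        ENNReal.ofReal C * L := by
    intro L hL hL'
    rw [hdist] at hL
    obtain ⟨γ, h0, h1, hγ, hlen⟩ := F.exists_pathELength_lt hL
    have hmem : ∀ t ∈ Icc (0 : ℝ) 1, γ t ∈ Metric.eball b₀ R := by
      intro t ht
      let := F.tangentENorm
      have h2 : edist (γ 0) (γ t) < R / 3 + R / 3 := by
        rw [hdist]
        refine (F.finslerEDist_le_pathELength (hγ.mono (Icc_subset_Icc_right ht.2)) ht.1).trans_lt
          (lt_of_le_of_lt ?_ (hlen.trans hL'))
        exact Manifold.pathELength_mono le_rfl ht.2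
      rw [Metric.mem_eball, ← hR3, add_comm]
      refine (edist_triangle _ (γ 0) _).trans_lt (ENNReal.add_lt_add ?_ ?_)
      · rwa [edist_comm]
      · rw [h0]; exact hbr
    have h3 := F.ofReal_abs_sub_le_pathELength (x₀ := x₀) hγ (fun t ht => (hsub (hmem t ht)).2)
      (LinearMap.toContinuousLinearMap l) (zero_le_one.trans hC.le)
      (fun t ht w => (hl w).trans ((hsub (hmem t ht)).1 w).2)
    rw [h0, h1] at h3
    have h4 : |LinearMap.toContinuousLinearMap l (extChartAt (𝓡 n) x₀ b' -
        extChartAt (𝓡 n) x₀ b)| =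
        F.localNorm x₀ b₀ (extChartAt (𝓡 n) x₀ b' - extChartAt (𝓡 n) x₀ b) := by
      rw [LinearMap.coe_toContinuousLinearMap', hlx, abs_of_nonneg (apply_nonneg _ _)]
    rw [h4] at h3
    exact h3.trans (mul_le_mul_right hlen.le _)
  have hC0 : ENNReal.ofReal C ≠ 0 := by simpa using zero_lt_one.trans hC
  rw [mul_comm, ← ENNReal.div_le_iff hC0 ENNReal.ofReal_ne_top]
  refine le_of_forall_gt_imp_ge_of_dense fun L hL => ?_
  rcases lt_or_ge L (R / 3 + R / 3) with h | h
  · rw [ENNReal.div_le_iff hC0 ENNReal.ofReal_ne_top, mul_comm]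
    exact hkey L hL h
  -- For large `L` a path of length below `L` could leave the ball, so a smaller bound `L'` is used.
  · obtain ⟨L', h1, h2⟩ := exists_between hbb'
    refine le_trans ?_ (h2.le.trans h)
    rw [ENNReal.div_le_iff hC0 ENNReal.ofReal_ne_top, mul_comm]
    exact hkey L' h1 h2

/-- Near the image of `b₀` in a chart, the Finsler distance is at most `C` times the norm at `b₀`
of the increment, for any `C > 1`. -/
theorem exists_ball_edist_le_localNorm (F : FinslerStructure n M)
    (hdist : ∀ x y : M, edist x y = F.finslerEDist x y) {x₀ b₀ : M}
    (hb : b₀ ∈ (chartAt (EuclideanSpace ℝ (Fin n)) x₀).source) {C : ℝ} (hC : 1 < C) :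
    ∃ r > 0, Metric.ball (extChartAt (𝓡 n) x₀ b₀) r ⊆ (extChartAt (𝓡 n) x₀).target ∧
      ∀ y ∈ Metric.ball (extChartAt (𝓡 n) x₀ b₀) r, ∀ z ∈ Metric.ball (extChartAt (𝓡 n) x₀ b₀) r,
        edist ((extChartAt (𝓡 n) x₀).symm y) ((extChartAt (𝓡 n) x₀).symm z) ≤
          ENNReal.ofReal (C * F.localNorm x₀ b₀ (z - y)) := by
  have hb' : b₀ ∈ (extChartAt (𝓡 n) x₀).source := by rwa [extChartAt_source]
  have htgt : (extChartAt (𝓡 n) x₀).target ∈ 𝓝 (extChartAt (𝓡 n) x₀ b₀) :=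
    (isOpen_extChartAt_target x₀).mem_nhds ((extChartAt (𝓡 n) x₀).map_source hb')
  have hcont : ContinuousAt (extChartAt (𝓡 n) x₀).symm (extChartAt (𝓡 n) x₀ b₀) :=
    continuousAt_extChartAt_symm'' ((extChartAt (𝓡 n) x₀).map_source hb')
  have hev := F.eventually_localNorm_le_mul hb hC
  rw [← (extChartAt (𝓡 n) x₀).left_inv hb'] at hev
  obtain ⟨r, hr, hsub⟩ := Metric.mem_nhds_iff.1 (inter_mem htgt (hcont.eventually hev))
  refine ⟨r, hr, hsub.trans inter_subset_left, fun y hy z hz => ?_⟩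
  have hseg : segment ℝ y z ⊆ Metric.ball (extChartAt (𝓡 n) x₀ b₀) r :=
    (convex_ball _ _).segment_subset hy hz
  rw [hdist]
  refine F.finslerEDist_le_of_segment (hseg.trans (hsub.trans inter_subset_left)) fun w hw => ?_
  have h := ((hsub (hseg hw)).2 (z - y)).1
  rwa [(extChartAt (𝓡 n) x₀).left_inv hb'] at h

end FinslerStructure

/-! ### Energy of paths with a given speed -/

section pathEnergy

variable {X : Type*} [PseudoEMetricSpace X] {α : ℝ → X} {a b : ℝ}

/-- Each term is at most `K²` times the length of its interval, and the lengths telescope. The bound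
also shows that the energy is finite, so that `toReal` loses nothing. -/
theorem pathEnergy_le_of_edist_le {K : ℝ} (hK : 0 ≤ K)
    (h : ∀ s ∈ Icc a b, ∀ t ∈ Icc a b, s ≤ t →
      edist (α s) (α t) ≤ ENNReal.ofReal (K * (t - s))) :
    pathEnergy α a b ≤ ENNReal.ofReal (K ^ 2 * (b - a)) := by
  refine iSup_le fun m => iSup_le fun t => iSup_le fun h0 => iSup_le fun hm => iSup_le fun hk => ?_
  have hmono : ∀ i j, i ≤ j → j ≤ m → t i ≤ t j := by
    intro i j hij
    induction j, hij using Nat.le_induction with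
    | base => exact fun _ => le_rfl
    | succ j _ ih => exact fun hj => (ih (by lia)).trans (hk j (by lia)).le
  have hmem : ∀ i ≤ m, t i ∈ Icc a b := fun i hi =>
    ⟨h0 ▸ hmono 0 i (Nat.zero_le i) hi, hm ▸ hmono i m hi le_rfl⟩
  calc _ ≤ ∑ k ∈ Finset.range m, ENNReal.ofReal (K ^ 2 * (t (k + 1) - t k)) := by
        refine Finset.sum_le_sum fun k hkm => ?_
        rw [Finset.mem_range] at hkm
        have hpos : 0 < t (k + 1) - t k := sub_pos.2 (hk k hkm)
        refine ENNReal.div_le_of_le_mul ?_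
        rw [← ENNReal.ofReal_mul (by positivity)]
        refine (pow_le_pow_left' (h _ (hmem k hkm.le) _ (hmem (k + 1) hkm) (hk k hkm).le) 2).trans ?_
        rw [← ENNReal.ofReal_pow (by positivity)]
        exact ENNReal.ofReal_le_ofReal (by nlinarith)
    _ = ENNReal.ofReal (K ^ 2 * (b - a)) := by
        rw [← ENNReal.ofReal_sum_of_nonneg, ← Finset.mul_sum, Finset.sum_range_sub, h0, hm]
        intro k hkm
        exact mul_nonneg (sq_nonneg K) (sub_nonneg.2 (hk k (Finset.mem_range.1 hkm)).le)

theorem edist_sq_div_le_pathEnergy (hab : a < b) :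
    edist (α a) (α b) ^ 2 / ENNReal.ofReal (b - a) ≤ pathEnergy α a b := by
  -- The subdivision with the single interval `[a, b]`; values of `t` beyond index `1` play no role.
  refine le_trans ?_ (le_iSup_of_le 1 (le_iSup_of_le (fun k => if k = 0 then a else b)
    (le_iSup_of_le (by simp) (le_iSup_of_le (by simp) (le_iSup_of_le (by simpa) le_rfl)))))
  simp

/-- A path with speed `ν` at `t₀` has energy of order `ν² h` on `[t₀, t₀ + h]`. -/
theorem tendsto_pathEnergy_div {t₀ ν : ℝ} (hν : 0 ≤ ν)
    (hup : ∀ C : ℝ, 1 < C → ∀ᶠ h in 𝓝[>] (0 : ℝ), ∀ s ∈ Icc t₀ (t₀ + h), ∀ t ∈ Icc t₀ (t₀ + h),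
      s ≤ t → edist (α s) (α t) ≤ ENNReal.ofReal (C * ν * (t - s)))
    (hlow : ∀ C : ℝ, 1 < C → ∀ᶠ h in 𝓝[>] (0 : ℝ),
      ENNReal.ofReal (ν * h) ≤ ENNReal.ofReal C * edist (α t₀) (α (t₀ + h))) :
    Tendsto (fun h => (pathEnergy α t₀ (t₀ + h)).toReal / h) (𝓝[>] 0) (𝓝 (ν ^ 2)) := by
  refine tendsto_order.2 ⟨fun l hl => ?_, fun u hu => ?_⟩
  -- Lower bound, with `C` so close to `1` that `(ν / C)² > l`: the one-interval subdivision
  -- suffices, and `hup` serves only for finiteness.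
  · have hc : Tendsto (fun C : ℝ => (ν / C) ^ 2) (𝓝[>] 1) (𝓝 ((ν / 1) ^ 2)) :=
      ((tendsto_const_nhds.div tendsto_id one_ne_zero).pow 2).mono_left nhdsWithin_le_nhds
    rw [div_one] at hc
    obtain ⟨C, hCl, hC⟩ := ((hc.eventually (lt_mem_nhds hl)).and self_mem_nhdsWithin).exists
    have hC0 : (0 : ℝ) < C := zero_lt_one.trans hC
    filter_upwards [hup C hC, hlow C hC, self_mem_nhdsWithin] with h h1 h2 h3
    have h3 : 0 < h := h3
    refine hCl.trans_le ?_
    have hfin : pathEnergy α t₀ (t₀ + h) ≠ ⊤ :=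
      ((pathEnergy_le_of_edist_le (mul_nonneg hC0.le hν) h1).trans_lt ENNReal.ofReal_lt_top).ne
    have hd : edist (α t₀) (α (t₀ + h)) ≠ ⊤ :=
      ((h1 _ ⟨le_rfl, by linarith⟩ _ ⟨by linarith, le_rfl⟩ (by linarith)).trans_lt
        ENNReal.ofReal_lt_top).ne
    have h4 := ENNReal.toReal_mono hfin
      (edist_sq_div_le_pathEnergy (α := α) (show t₀ < t₀ + h by linarith))
    rw [ENNReal.toReal_div, ENNReal.toReal_pow, add_sub_cancel_left,
      ENNReal.toReal_ofReal h3.le] at h4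
    have h5 := ENNReal.toReal_mono (ENNReal.mul_ne_top ENNReal.ofReal_ne_top hd) h2
    rw [ENNReal.toReal_mul, ENNReal.toReal_ofReal hC0.le,
      ENNReal.toReal_ofReal (mul_nonneg hν h3.le)] at h5
    set d := (edist (α t₀) (α (t₀ + h))).toReal
    have h6 : ν / C ≤ d / h := by
      rw [div_le_div_iff₀ hC0 h3]; linarith
    calc (ν / C) ^ 2 ≤ (d / h) ^ 2 := by gcongr
      _ = d ^ 2 / h / h := by field_simp
      _ ≤ _ := by gcongr
  · have hc : Tendsto (fun C : ℝ => (C * ν) ^ 2) (𝓝[>] 1) (𝓝 ((1 * ν) ^ 2)) :=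
      ((tendsto_id.mul_const ν).pow 2).mono_left nhdsWithin_le_nhds
    rw [one_mul] at hc
    obtain ⟨C, hCu, hC⟩ := ((hc.eventually (gt_mem_nhds hu)).and self_mem_nhdsWithin).exists
    have hC0 : (0 : ℝ) < C := zero_lt_one.trans hC
    filter_upwards [hup C hC, self_mem_nhdsWithin] with h h1 h3
    have h3 : 0 < h := h3
    refine lt_of_le_of_lt ?_ hCu
    have h2 := pathEnergy_le_of_edist_le (mul_nonneg hC0.le hν) h1
    rw [add_sub_cancel_left] at h2
    have h4 := ENNReal.toReal_mono ENNReal.ofReal_ne_top h2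
    rw [ENNReal.toReal_ofReal (by positivity)] at h4
    rwa [div_le_iff₀ h3]

theorem lipschitzOnWith_Icc_of_edist_le {K : ℝ} (hK : 0 ≤ K)
    (h : ∀ s ∈ Icc a b, ∀ t ∈ Icc a b, s ≤ t →
      edist (α s) (α t) ≤ ENNReal.ofReal (K * (t - s))) :
    LipschitzOnWith K.toNNReal α (Icc a b) := by
  have key : ∀ s ∈ Icc a b, ∀ t ∈ Icc a b, s ≤ t →
      edist (α s) (α t) ≤ K.toNNReal * edist s t := by
    intro s hs t ht hst
    refine (h s hs t ht hst).trans_eq ?_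
    rw [ENNReal.ofReal_mul hK, edist_comm s t, edist_dist, Real.dist_eq,
      abs_of_nonneg (sub_nonneg.2 hst)]
    rfl
  intro s hs t ht
  rcases le_total s t with hst | hst
  · exact key s hs t ht hst
  · rw [edist_comm, edist_comm s t]
    exact key t ht s hs hst

end pathEnergy

/-! ### Energy along the lines of a chart -/

namespace FinslerStructure

variable {n : ℕ} {M : Type*} [EMetricSpace M]
  [ChartedSpace (EuclideanSpace ℝ (Fin n)) M] [IsManifold (𝓡 n) 1 M]

/-- Speed bounds for the coordinate lines of a chart. -/
theorem eventually_edist_line_le (F : FinslerStructure n M)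
    (hdist : ∀ x y : M, edist x y = F.finslerEDist x y) (x₀ : M)
    {y v : EuclideanSpace ℝ (Fin n)} {t₀ : ℝ} (hy : y + t₀ • v ∈ (extChartAt (𝓡 n) x₀).target)
    {C : ℝ} (hC : 1 < C) :
    ∀ᶠ h in 𝓝[>] (0 : ℝ), ∀ s ∈ Icc t₀ (t₀ + h), ∀ t ∈ Icc t₀ (t₀ + h), s ≤ t →
      edist ((extChartAt (𝓡 n) x₀).symm (y + s • v)) ((extChartAt (𝓡 n) x₀).symm (y + t • v)) ≤
        ENNReal.ofReal (C * F.localNorm x₀ ((extChartAt (𝓡 n) x₀).symm (y + t₀ • v)) v *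
          (t - s)) := by
  have hb : (extChartAt (𝓡 n) x₀).symm (y + t₀ • v) ∈
      (chartAt (EuclideanSpace ℝ (Fin n)) x₀).source := by
    rw [← extChartAt_source (𝓡 n)]
    exact (extChartAt (𝓡 n) x₀).map_target hy
  obtain ⟨r, hr, -, hball⟩ := F.exists_ball_edist_le_localNorm hdist hb hC
  rw [(extChartAt (𝓡 n) x₀).right_inv hy] at hball
  have hcont : Continuous fun t : ℝ => y + t • v := by fun_prop
  obtain ⟨δ, hδ, hsub⟩ := Metric.mem_nhds_iff.1
    (hcont.continuousAt.preimage_mem_nhds (Metric.ball_mem_nhds (y + t₀ • v) hr))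
  filter_upwards [Ioo_mem_nhdsGT hδ] with h hh s hs t ht hst
  have hmem : ∀ s ∈ Icc t₀ (t₀ + h), y + s • v ∈ Metric.ball (y + t₀ • v) r := by
    intro s hs
    refine hsub (a := s) ?_
    rw [Metric.mem_ball, Real.dist_eq, abs_of_nonneg (sub_nonneg.2 hs.1)]
    linarith [hs.2, hh.2]
  refine (hball _ (hmem s hs) _ (hmem t ht)).trans_eq ?_
  rw [add_sub_add_left_eq_sub, ← sub_smul, map_smul_eq_mul,
    Real.norm_of_nonneg (sub_nonneg.2 hst)]
  ring_nf

theorem eventually_le_edist_line (F : FinslerStructure n M)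
    (hdist : ∀ x y : M, edist x y = F.finslerEDist x y) (x₀ : M)
    {y v : EuclideanSpace ℝ (Fin n)} {t₀ : ℝ} (hy : y + t₀ • v ∈ (extChartAt (𝓡 n) x₀).target)
    {C : ℝ} (hC : 1 < C) :
    ∀ᶠ h in 𝓝[>] (0 : ℝ),
      ENNReal.ofReal (F.localNorm x₀ ((extChartAt (𝓡 n) x₀).symm (y + t₀ • v)) v * h) ≤
        ENNReal.ofReal C * edist ((extChartAt (𝓡 n) x₀).symm (y + t₀ • v))
          ((extChartAt (𝓡 n) x₀).symm (y + (t₀ + h) • v)) := by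
  have hb : (extChartAt (𝓡 n) x₀).symm (y + t₀ • v) ∈
      (chartAt (EuclideanSpace ℝ (Fin n)) x₀).source := by
    rw [← extChartAt_source (𝓡 n)]
    exact (extChartAt (𝓡 n) x₀).map_target hy
  obtain ⟨r, hr, hball⟩ := F.exists_eball_localNorm_le_edist hdist hb hC
  have hcont : ContinuousAt (fun h : ℝ => y + (t₀ + h) • v) 0 := by fun_prop
  have hy0 : y + (t₀ + 0) • v ∈ (extChartAt (𝓡 n) x₀).target := by rwa [add_zero]
  have h1 : ∀ᶠ h in 𝓝 (0 : ℝ), y + (t₀ + h) • v ∈ (extChartAt (𝓡 n) x₀).target :=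
    hcont.eventually ((isOpen_extChartAt_target x₀).mem_nhds hy0)
  have hcont2 : ContinuousAt (fun h : ℝ => (extChartAt (𝓡 n) x₀).symm (y + (t₀ + h) • v)) 0 :=
    ContinuousAt.comp (g := (extChartAt (𝓡 n) x₀).symm) (continuousAt_extChartAt_symm'' hy0) hcont
  have h2 := hcont2.eventually (Metric.eball_mem_nhds _ hr)
  simp only [add_zero] at h2
  filter_upwards [nhdsWithin_le_nhds h1, nhdsWithin_le_nhds h2, self_mem_nhdsWithin]
    with h hh1 hh2 hh3
  have hh3 : 0 < h := hh3
  have h3 := hball _ (Metric.mem_eball_self hr) _ hh2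
  rw [(extChartAt (𝓡 n) x₀).right_inv hy, (extChartAt (𝓡 n) x₀).right_inv hh1,
    add_sub_add_left_eq_sub, ← sub_smul, add_sub_cancel_left, map_smul_eq_mul,
    Real.norm_of_nonneg hh3.le, mul_comm] at h3
  exact h3

/-- The density exists at every time of the line, not just almost every one, and is continuous in
the base point. -/
theorem tendsto_pathEnergy_line_div (F : FinslerStructure n M)
    (hdist : ∀ x y : M, edist x y = F.finslerEDist x y) (x₀ : M)
    {y v : EuclideanSpace ℝ (Fin n)} {t₀ : ℝ}
    (hy : y + t₀ • v ∈ (extChartAt (𝓡 n) x₀).target) :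
    Tendsto (fun h => (pathEnergy (fun t : ℝ => (extChartAt (𝓡 n) x₀).symm (y + t • v))
      t₀ (t₀ + h)).toReal / h) (𝓝[>] 0)
      (𝓝 (F.localNorm x₀ ((extChartAt (𝓡 n) x₀).symm (y + t₀ • v)) v ^ 2)) :=
  tendsto_pathEnergy_div (apply_nonneg _ _)
    (fun _ hC => F.eventually_edist_line_le hdist x₀ hy hC)
    (fun _ hC => F.eventually_le_edist_line hdist x₀ hy hC)

theorem eventually_hasEnergy_line (F : FinslerStructure n M)
    (hdist : ∀ x y : M, edist x y = F.finslerEDist x y) {p q : ℕ} {f : M → MinkowskiSpace p q}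
    (hiso : IsPathIsometry f) (x₀ : M) {y v : EuclideanSpace ℝ (Fin n)} {t₀ : ℝ}
    (hy : y + t₀ • v ∈ (extChartAt (𝓡 n) x₀).target) :
    ∀ᶠ h in 𝓝[>] (0 : ℝ), MinkowskiSpace.HasEnergy
      (fun t : ℝ => f ((extChartAt (𝓡 n) x₀).symm (y + t • v))) t₀ (t₀ + h)
      (pathEnergy (fun t : ℝ => (extChartAt (𝓡 n) x₀).symm (y + t • v)) t₀ (t₀ + h)).toReal := by
  filter_upwards [F.eventually_edist_line_le hdist x₀ hy one_lt_two, self_mem_nhdsWithin]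
    with h hh hpos
  exact hiso _ _ _ (lt_add_of_pos_right t₀ hpos)
    ⟨_, lipschitzOnWith_Icc_of_edist_le (mul_nonneg zero_le_two (apply_nonneg _ _)) hh⟩

end FinslerStructure

/-! ### Energy of Lipschitz paths in Minkowski space -/

/-- Difference quotients over shrinking intervals which contain a point of differentiability
converge to the derivative. -/
theorem HasDerivAt.tendsto_straddle {V ι : Type*} [NormedAddCommGroup V] [NormedSpace ℝ V]
    {β : ℝ → V} {β' : V} {t : ℝ} (h : HasDerivAt β β' t) {l : Filter ι} {s δ : ι → ℝ}
    (hs : ∀ᶠ i in l, s i ≤ t ∧ t ≤ s i + δ i) (hδ : ∀ᶠ i in l, 0 < δ i)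
    (hlim : Tendsto δ l (𝓝 0)) :
    Tendsto (fun i => (δ i)⁻¹ • (β (s i + δ i) - β (s i))) l (𝓝 β') := by
  rw [Metric.tendsto_nhds]
  intro ε hε
  have h1 := (hasDerivAt_iff_isLittleO.1 h).def (half_pos hε)
  obtain ⟨ρ, hρ, hball⟩ := Metric.mem_nhds_iff.1 h1
  filter_upwards [hs, hδ, hlim.eventually (gt_mem_nhds hρ)] with i hi hδi hρi
  have h2 : ‖β (s i) - β t - (s i - t) • β'‖ ≤ ε / 2 * ‖s i - t‖ :=
    hball (by rw [Metric.mem_ball, Real.dist_eq, abs_of_nonpos] <;> linarith [hi.1, hi.2])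
  have h3 : ‖β (s i + δ i) - β t - (s i + δ i - t) • β'‖ ≤ ε / 2 * ‖s i + δ i - t‖ :=
    hball (by rw [Metric.mem_ball, Real.dist_eq, abs_of_nonneg] <;> linarith [hi.1, hi.2])
  rw [Real.norm_eq_abs, abs_of_nonpos (by linarith [hi.1])] at h2
  rw [Real.norm_eq_abs, abs_of_nonneg (by linarith [hi.2])] at h3
  -- The first-order errors at the two end points add up to at most `ε / 2 * δ i`, because `t` lies
  -- between them.
  have h4 : (δ i)⁻¹ • (β (s i + δ i) - β (s i)) - β' =
      (δ i)⁻¹ • ((β (s i + δ i) - β t - (s i + δ i - t) • β') -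
        (β (s i) - β t - (s i - t) • β')) := by
    have h5 : β' = (δ i)⁻¹ • (δ i • β') := by rw [smul_smul, inv_mul_cancel₀ hδi.ne', one_smul]
    conv_lhs => rw [h5]
    rw [← smul_sub]
    congr 1
    module
  rw [dist_eq_norm, h4, norm_smul, norm_inv, Real.norm_of_nonneg hδi.le]
  calc _ ≤ (δ i)⁻¹ * (ε / 2 * δ i) := by
        gcongr
        refine (norm_sub_le _ _).trans ?_
        linarith
    _ = ε / 2 := by field_simp
    _ < ε := half_lt_self hε

namespace MinkowskiSpace

variable {p q : ℕ}

theorem continuous_quadForm : Continuous (quadForm : MinkowskiSpace p q → ℝ) := by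
  unfold quadForm; fun_prop

theorem quadForm_smul (c : ℝ) (z : MinkowskiSpace p q) :
    quadForm (c • z) = c ^ 2 * quadForm z := by
  simp only [quadForm, Prod.smul_fst, Prod.smul_snd, norm_smul, mul_pow, Real.norm_eq_abs, sq_abs]
  ring

theorem abs_quadForm_le (z : MinkowskiSpace p q) : |quadForm z| ≤ ‖z‖ ^ 2 := by
  have h1 : ‖z.1‖ ^ 2 ≤ ‖z‖ ^ 2 := by gcongr; exact norm_fst_le z
  have h2 : ‖z.2‖ ^ 2 ≤ ‖z‖ ^ 2 := by gcongr; exact norm_snd_le z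
  rw [quadForm, abs_le]
  constructor <;> nlinarith [sq_nonneg ‖z.1‖, sq_nonneg ‖z.2‖]

/-- The energy sum is the integral of a step function. -/
theorem energySum_eq_integral (β : ℝ → MinkowskiSpace p q) {a b : ℝ} (hab : a < b) {N : ℕ}
    (hN : N ≠ 0) :
    energySum β a b N = ∫ t in a..b, quadForm (((b - a) / N)⁻¹ •
      (β (a + ⌊(t - a) / ((b - a) / N)⌋₊ * ((b - a) / N) + (b - a) / N) -
        β (a + ⌊(t - a) / ((b - a) / N)⌋₊ * ((b - a) / N)))) := by
  have hN' : (0 : ℝ) < N := by positivity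
  set δ := (b - a) / N with hδ
  have hδ0 : 0 < δ := div_pos (sub_pos.2 hab) hN'
  -- The form has degree two, so the `k`-th energy term is `δ * G k`, the integral of the constant
  -- `G k` over the `k`-th interval.
  set G : ℕ → ℝ := fun k => quadForm (δ⁻¹ • (β (a + k * δ + δ) - β (a + k * δ))) with hG
  have hpiece : ∀ k : ℕ, EqOn (fun t => G ⌊(t - a) / δ⌋₊) (fun _ => G k)
      (Ioo (a + k * δ) (a + (k + 1 : ℕ) * δ)) := by
    intro k t ht
    have : ⌊(t - a) / δ⌋₊ = k := by
      rw [Nat.floor_eq_iff (div_nonneg (by nlinarith [ht.1, (Nat.cast_nonneg k : (0:ℝ) ≤ k)])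
        hδ0.le), le_div_iff₀ hδ0, div_lt_iff₀ hδ0]
      have := ht.2
      push_cast at this
      exact ⟨by linarith [ht.1], by linarith⟩
    simp only [this]
  have hle : ∀ k : ℕ, a + k * δ ≤ a + (k + 1 : ℕ) * δ := fun k => by
    push_cast; linarith
  have hae : ∀ k : ℕ, ∀ᵐ t, t ∈ Set.uIoc (a + k * δ) (a + (k + 1 : ℕ) * δ) →
      G ⌊(t - a) / δ⌋₊ = G k := by
    intro k
    have : ∀ᵐ t : ℝ, t ≠ a + (k + 1 : ℕ) * δ := by
      simp [MeasureTheory.ae_iff]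
    filter_upwards [this] with t ht hmem
    rw [Set.uIoc_of_le (hle k)] at hmem
    exact hpiece k ⟨hmem.1, lt_of_le_of_ne hmem.2 ht⟩
  have hint : ∀ k < N, IntervalIntegrable (fun t => G ⌊(t - a) / δ⌋₊) MeasureTheory.volume
      (a + k * δ) (a + (k + 1 : ℕ) * δ) := by
    intro k _
    refine (intervalIntegrable_const (c := G k)).congr_ae ?_
    rw [Filter.EventuallyEq, MeasureTheory.ae_restrict_iff' measurableSet_uIoc]
    filter_upwards [hae k] with t ht hmem using (ht hmem).symm
  have hsum := intervalIntegral.sum_integral_adjacent_intervals (a := fun k : ℕ => a + k * δ) hint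
  have hend : a + N * δ = b := by rw [hδ]; field_simp; ring
  rw [Nat.cast_zero, zero_mul, add_zero, hend] at hsum
  rw [energySum, ← hδ]
  refine Eq.trans (Finset.sum_congr rfl fun k _ => ?_) hsum
  rw [intervalIntegral.integral_congr_ae (hae k), intervalIntegral.integral_const, hG]
  simp only [quadForm_smul, smul_eq_mul]
  push_cast
  rw [show a + (k + 1) * δ = a + k * δ + δ by ring, add_sub_cancel_left]
  field_simp

/-- A Lipschitz path in Minkowski space has an energy. -/
theorem hasEnergy_integral_quadForm_deriv {β : ℝ → MinkowskiSpace p q} {K : ℝ≥0}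
    (hβ : LipschitzWith K β) {a b : ℝ} (hab : a < b) :
    HasEnergy β a b (∫ t in a..b, quadForm (deriv β t)) := by
  have hev : ∀ᶠ N : ℕ in atTop, (∫ t in a..b, quadForm (((b - a) / N)⁻¹ •
      (β (a + ⌊(t - a) / ((b - a) / N)⌋₊ * ((b - a) / N) + (b - a) / N) -
        β (a + ⌊(t - a) / ((b - a) / N)⌋₊ * ((b - a) / N))))) = energySum β a b N := by
    filter_upwards [eventually_ne_atTop 0] with N hN
    exact (energySum_eq_integral β hab hN).symm
  refine Tendsto.congr' hev ?_
  have hδpos : ∀ᶠ N : ℕ in atTop, 0 < (b - a) / N := by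
    filter_upwards [eventually_gt_atTop 0] with N hN
    exact div_pos (sub_pos.2 hab) (by positivity)
  -- Difference quotients are bounded by `K` and, by Rademacher, converge to the velocity almost
  -- everywhere.
  refine intervalIntegral.tendsto_integral_filter_of_dominated_convergence
    (fun _ => (K : ℝ) ^ 2) ?_ ?_ intervalIntegrable_const ?_
  · refine Eventually.of_forall fun N => Measurable.aestronglyMeasurable ?_
    have hfl : Measurable fun t : ℝ => ⌊(t - a) / ((b - a) / N)⌋₊ :=
      Nat.measurable_floor.comp (by fun_prop)
    exact (measurable_from_nat (f := fun k : ℕ => quadForm (((b - a) / N)⁻¹ •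
      (β (a + k * ((b - a) / N) + (b - a) / N) - β (a + k * ((b - a) / N)))))).comp hfl
  · filter_upwards [hδpos] with N hN
    refine Eventually.of_forall fun t _ => ?_
    refine (abs_quadForm_le _).trans ?_
    gcongr
    rw [norm_smul, norm_inv, Real.norm_of_nonneg hN.le, inv_mul_le_iff₀ hN]
    refine (hβ.norm_sub_le _ _).trans ?_
    rw [add_sub_cancel_left, Real.norm_of_nonneg hN.le, mul_comm]
  · filter_upwards [hβ.ae_differentiableAt] with t ht hmem
    rw [Set.uIoc_of_le hab.le] at hmem
    refine (continuous_quadForm.tendsto _).comp (ht.hasDerivAt.tendsto_straddle ?_ hδpos ?_)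
    · filter_upwards [hδpos] with N hN
      have h0 : 0 ≤ (t - a) / ((b - a) / N) := div_nonneg (by linarith [hmem.1]) hN.le
      have h1 := Nat.floor_le h0
      have h2 := (Nat.lt_floor_add_one ((t - a) / ((b - a) / N))).le
      rw [le_div_iff₀ hN] at h1
      rw [div_le_iff₀ hN] at h2
      constructor <;> linarith
    · exact tendsto_const_div_atTop_nhds_zero_nat _

theorem locallyIntegrable_quadForm_deriv {β : ℝ → MinkowskiSpace p q} {K : ℝ≥0}
    (hβ : LipschitzWith K β) :
    MeasureTheory.LocallyIntegrable (fun t => quadForm (deriv β t)) := by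
  have hm : Measurable fun t => quadForm (deriv β t) :=
    continuous_quadForm.measurable.comp (measurable_deriv β)
  refine (MeasureTheory.memLp_top_of_bound hm.aestronglyMeasurable ((K : ℝ) ^ 2)
    (Eventually.of_forall fun t => ?_)).locallyIntegrable le_top
  refine (abs_quadForm_le _).trans ?_
  gcongr
  exact norm_deriv_le_of_lipschitz hβ

/-- At almost every time, the energy density of a Lipschitz path is the quadratic form of its
velocity. -/
theorem ae_eq_quadForm_deriv {β : ℝ → MinkowskiSpace p q} {K : ℝ≥0} (hβ : LipschitzWith K β) :
    ∀ᵐ t, ∀ (e : ℝ → ℝ) (c : ℝ), (∀ᶠ h in 𝓝[>] (0 : ℝ), HasEnergy β t (t + h) (e h)) →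
      Tendsto (fun h => e h / h) (𝓝[>] 0) (𝓝 c) → c = quadForm (deriv β t) := by
  -- The null set of Lebesgue differentiation is independent of `e` and `c`, which may thus be
  -- chosen after `t`.
  filter_upwards [LocallyIntegrable.ae_hasDerivAt_integral (locallyIntegrable_quadForm_deriv hβ)]
    with t ht e c he hlim
  have h1 := (ht t).tendsto_slope_zero_right
  refine tendsto_nhds_unique (hlim.congr' ?_) h1
  filter_upwards [he, self_mem_nhdsWithin] with h hh hpos
  rw [tendsto_nhds_unique hh (hasEnergy_integral_quadForm_deriv hβ (lt_add_of_pos_right t hpos)),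
    intervalIntegral.integral_same, sub_zero, smul_eq_mul, inv_mul_eq_div]

end MinkowskiSpace

/-! ### Energy sums of the two projections -/

section energySums

variable {V : Type*} [NormedAddCommGroup V] {γ : ℝ → V} {a b : ℝ} {N : ℕ}

/-- Cauchy–Schwarz. No regularity of `γ` is needed, so this applies to the projection about which
nothing is known. -/
theorem norm_sub_sq_div_le_sum (hab : a < b) (hN : N ≠ 0) :
    ‖γ b - γ a‖ ^ 2 / (b - a) ≤ ∑ k ∈ Finset.range N,
      ‖γ (a + (k + 1) * ((b - a) / N)) - γ (a + k * ((b - a) / N))‖ ^ 2 / ((b - a) / N) := by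
  have hN' : (0 : ℝ) < N := by positivity
  have hba : 0 < b - a := sub_pos.2 hab
  have hsum := Finset.sum_range_sub (fun k : ℕ => γ (a + k * ((b - a) / N))) N
  have hend : a + N * ((b - a) / N) = b := by field_simp; ring
  simp only [hend, Nat.cast_zero, zero_mul, add_zero, Nat.cast_add, Nat.cast_one] at hsum
  rw [← hsum, ← Finset.sum_div, div_le_div_iff₀ hba (div_pos hba hN')]
  have h1 := norm_sum_le (Finset.range N) fun k : ℕ =>
    γ (a + (k + 1) * ((b - a) / N)) - γ (a + k * ((b - a) / N))
  have h2 := sq_sum_le_card_mul_sum_sq (s := Finset.range N) (f := fun k : ℕ =>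
    ‖γ (a + (k + 1) * ((b - a) / N)) - γ (a + k * ((b - a) / N))‖)
  rw [Finset.card_range] at h2
  have h3 := (pow_le_pow_left₀ (norm_nonneg _) h1 2).trans h2
  rw [mul_div_assoc', div_le_iff₀ hN']
  nlinarith

theorem sum_norm_sub_sq_div_le (hab : a < b) (hN : N ≠ 0) {A : ℝ}
    (h : ∀ s ∈ Icc a b, ∀ t ∈ Icc a b, s ≤ t → ‖γ t - γ s‖ ≤ A * (t - s)) :
    ∑ k ∈ Finset.range N,
      ‖γ (a + (k + 1) * ((b - a) / N)) - γ (a + k * ((b - a) / N))‖ ^ 2 / ((b - a) / N) ≤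
      A ^ 2 * (b - a) := by
  have hN' : (0 : ℝ) < N := by positivity
  have hend : a + N * ((b - a) / N) = b := by field_simp; ring
  set δ := (b - a) / N
  have hδ : 0 < δ := div_pos (sub_pos.2 hab) hN'
  have hmem : ∀ k : ℕ, k ≤ N → a + k * δ ∈ Icc a b := fun k hk => by
    have : (k : ℝ) ≤ N := by exact_mod_cast hk
    constructor
    · linarith [mul_nonneg (Nat.cast_nonneg k : (0 : ℝ) ≤ k) hδ.le]
    · rw [← hend]; gcongr
  calc _ ≤ ∑ k ∈ Finset.range N, A ^ 2 * δ := by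
        refine Finset.sum_le_sum fun k hk => ?_
        rw [Finset.mem_range] at hk
        have h1 := h _ (hmem k hk.le) _ (hmem (k + 1) hk) (by push_cast; linarith)
        push_cast at h1
        rw [show a + (k + 1) * δ - (a + k * δ) = δ by ring] at h1
        rw [div_le_iff₀ hδ]
        calc _ ≤ (A * δ) ^ 2 := by gcongr
          _ = _ := by ring
    _ = A ^ 2 * (b - a) := by
        rw [Finset.sum_const, Finset.card_range, nsmul_eq_mul, ← hend]; ring

end energySums

namespace MinkowskiSpace

variable {p q : ℕ} {β β' : ℝ → MinkowskiSpace p q} {a b e A : ℝ}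

theorem energySum_eq_sub (β : ℝ → MinkowskiSpace p q) (a b : ℝ) (N : ℕ) :
    energySum β a b N =
      ∑ k ∈ Finset.range N, ‖(β (a + (k + 1) * ((b - a) / N))).1 -
        (β (a + k * ((b - a) / N))).1‖ ^ 2 / ((b - a) / N) -
      ∑ k ∈ Finset.range N, ‖(β (a + (k + 1) * ((b - a) / N))).2 -
        (β (a + k * ((b - a) / N))).2‖ ^ 2 / ((b - a) / N) := by
  rw [← Finset.sum_sub_distrib, energySum]
  refine Finset.sum_congr rfl fun k _ => ?_
  rw [quadForm, sub_div, Prod.fst_sub, Prod.snd_sub]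

/-- Energy sums sample the path only in `[a, b]`; this permits replacing `f` by a global Lipschitz
extension. -/
theorem HasEnergy.congr (h : HasEnergy β a b e) (hab : a ≤ b) (hβ : EqOn β β' (Icc a b)) :
    HasEnergy β' a b e := by
  refine Tendsto.congr' ?_ h
  filter_upwards [eventually_ne_atTop 0] with N hN
  have hN' : (0 : ℝ) < N := by positivity
  have hend : a + N * ((b - a) / N) = b := by field_simp; ring
  have hδ : 0 ≤ (b - a) / N := div_nonneg (sub_nonneg.2 hab) hN'.le
  have hmem : ∀ k : ℕ, k ≤ N → a + k * ((b - a) / N) ∈ Icc a b := fun k hk => by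
    have : (k : ℝ) ≤ N := by exact_mod_cast hk
    constructor
    · linarith [mul_nonneg (Nat.cast_nonneg k : (0 : ℝ) ≤ k) hδ]
    · conv_rhs => rw [← hend]
      gcongr
  refine Finset.sum_congr rfl fun k hk => ?_
  rw [Finset.mem_range] at hk
  have h1 := hmem (k + 1) hk
  push_cast at h1
  rw [hβ (hmem k hk.le), hβ h1]

/-- If the positive part of a path is Lipschitz, then its energy controls the negative part. -/
theorem HasEnergy.norm_snd_sub_sq_le (h : HasEnergy β a b e) (hab : a < b)
    (hA : ∀ s ∈ Icc a b, ∀ t ∈ Icc a b, s ≤ t → ‖(β t).1 - (β s).1‖ ≤ A * (t - s)) :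
    ‖(β b).2 - (β a).2‖ ^ 2 / (b - a) ≤ A ^ 2 * (b - a) - e := by
  -- For each `N` the negative sum is the positive sum minus the energy sum.
  refine ge_of_tendsto (tendsto_const_nhds.sub h) ?_
  filter_upwards [eventually_ne_atTop 0] with N hN
  rw [energySum_eq_sub]
  have h1 := sum_norm_sub_sq_div_le (γ := fun t => (β t).1) hab hN hA
  have h2 := norm_sub_sq_div_le_sum (γ := fun t => (β t).2) hab hN
  linarith

/-- If the negative part of a path is Lipschitz, then its energy controls the positive part. -/
theorem HasEnergy.norm_fst_sub_sq_le (h : HasEnergy β a b e) (hab : a < b)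
    (hA : ∀ s ∈ Icc a b, ∀ t ∈ Icc a b, s ≤ t → ‖(β t).2 - (β s).2‖ ≤ A * (t - s)) :
    ‖(β b).1 - (β a).1‖ ^ 2 / (b - a) ≤ A ^ 2 * (b - a) + e := by
  refine ge_of_tendsto (tendsto_const_nhds.add h) ?_
  filter_upwards [eventually_ne_atTop 0] with N hN
  rw [energySum_eq_sub]
  have h1 := sum_norm_sub_sq_div_le (γ := fun t => (β t).2) hab hN hA
  have h2 := norm_sub_sq_div_le_sum (γ := fun t => (β t).1) hab hN
  linarith

/-- If the energies of a Lipschitz map `G` along the lines of direction `v` have a continuous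
density `ν`, then `ν` is almost everywhere the quadratic form of the derivative of `G`. -/
theorem ae_eq_quadForm_fderiv {E : Type*} [NormedAddCommGroup E] [NormedSpace ℝ E]
    [FiniteDimensional ℝ E] [MeasurableSpace E] [BorelSpace E] (μ : MeasureTheory.Measure E)
    [μ.IsAddHaarMeasure] {G : E → MinkowskiSpace p q} {K : ℝ≥0} (hG : LipschitzWith K G)
    {s : Set E} (hs : IsOpen s) {ν : E → ℝ} (hν : ContinuousOn ν s) (v : E)
    (H : ∀ (y : E) (t : ℝ), y + t • v ∈ s → ∃ e : ℝ → ℝ,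
      (∀ᶠ h in 𝓝[>] (0 : ℝ), HasEnergy (fun t => G (y + t • v)) t (t + h) (e h)) ∧
      Tendsto (fun h => e h / h) (𝓝[>] 0) (𝓝 (ν (y + t • v)))) :
    ∀ᵐ y ∂μ, y ∈ s → ν y = quadForm (fderiv ℝ G y v) := by
  -- Line derivatives are used until the end: the null set where `G` is not differentiable may
  -- contain whole lines.
  have hmeas : MeasurableSet {y | s.indicator ν y =
      s.indicator (fun y => quadForm (lineDeriv ℝ G y v)) y} := by
    refine measurableSet_eq_fun ?_ ?_
    · classical
      rw [← Set.piecewise_eq_indicator]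
      exact hν.measurable_piecewise continuousOn_const hs.measurableSet
    · exact (continuous_quadForm.measurable.comp (measurable_lineDeriv hG.continuous)).indicator
        hs.measurableSet
  -- Fubini: a measurable set of full measure along every translate of `t ↦ t • v` has full measure.
  have hline := MeasureTheory.ae_mem_of_ae_add_linearMap_mem
    ((LinearMap.id : ℝ →ₗ[ℝ] ℝ).smulRight v) MeasureTheory.volume μ hmeas (fun y => by
      let L : ℝ →L[ℝ] E := ContinuousLinearMap.smulRight (1 : ℝ →L[ℝ] ℝ) v
      have hβ : LipschitzWith (K * (0 + ‖L‖₊)) fun t : ℝ => G (y + t • v) :=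
        hG.comp ((LipschitzWith.const y).add L.lipschitz)
      filter_upwards [ae_eq_quadForm_deriv hβ] with t ht
      change s.indicator ν (y + t • v) =
        s.indicator (fun y => quadForm (lineDeriv ℝ G y v)) (y + t • v)
      by_cases hmem : y + t • v ∈ s
      · rw [indicator_of_mem hmem, indicator_of_mem hmem]
        obtain ⟨e, he, hlim⟩ := H y t hmem
        rw [ht e _ he hlim, lineDeriv]
        congr 1
        have h1 := deriv_comp_const_add (fun t : ℝ => G (y + t • v)) t 0
        rw [add_zero] at h1
        rw [← h1]
        simp only [add_smul, add_assoc]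
      · rw [indicator_of_notMem hmem, indicator_of_notMem hmem])
  filter_upwards [hline, hG.ae_differentiableAt] with y hy hd hmem
  have hy : s.indicator ν y = s.indicator (fun y => quadForm (lineDeriv ℝ G y v)) y := hy
  rwa [indicator_of_mem hmem, indicator_of_mem hmem, hd.lineDeriv_eq_fderiv] at hy

end MinkowskiSpace

/-! ### Quadratic seminorms and Riemannian metrics -/

namespace Seminorm

section

variable {E F : Type*} [AddCommGroup E] [Module ℝ E] [AddCommGroup F] [Module ℝ F]

/-- The polarization of a seminorm. -/
noncomputable def polar (p : Seminorm ℝ E) (u w : E) : ℝ := (p (u + w) ^ 2 - p (u - w) ^ 2) / 4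

/-- A seminorm is quadratic if its polarization is linear in the first variable. -/
def IsQuadratic (p : Seminorm ℝ E) : Prop :=
  (∀ u u' w, p.polar (u + u') w = p.polar u w + p.polar u' w) ∧
    ∀ (c : ℝ) (u w), p.polar (c • u) w = c * p.polar u w

theorem polar_comm (p : Seminorm ℝ E) (u w : E) : p.polar u w = p.polar w u := by
  rw [polar, polar, add_comm, map_sub_rev]

theorem polar_self (p : Seminorm ℝ E) (u : E) : p.polar u u = p u ^ 2 := by
  rw [polar, sub_self, map_zero, ← two_smul ℝ u, map_smul_eq_mul, Real.norm_two]
  ring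

theorem polar_comp (p : Seminorm ℝ F) (L : E →ₗ[ℝ] F) (u w : E) :
    (p.comp L).polar u w = p.polar (L u) (L w) := by
  simp [polar]

theorem IsQuadratic.comp {p : Seminorm ℝ F} (hp : p.IsQuadratic) (L : E →ₗ[ℝ] F) :
    (p.comp L).IsQuadratic :=
  ⟨fun u u' w => by simp only [polar_comp, map_add, hp.1],
    fun c u w => by simp only [polar_comp, map_smul, hp.2]⟩

end

variable {E : Type*} [NormedAddCommGroup E] [NormedSpace ℝ E] [FiniteDimensional ℝ E]

theorem continuous_of_finiteDimensional (p : Seminorm ℝ E) : Continuous p := by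
  rw [← continuousOn_univ]
  exact p.convexOn.continuousOn isOpen_univ

/-- The bilinear form of a quadratic seminorm. -/
noncomputable def IsQuadratic.bilin {p : Seminorm ℝ E} (hp : p.IsQuadratic) :
    E →L[ℝ] E →L[ℝ] ℝ :=
  (LinearMap.mk₂ ℝ p.polar hp.1 hp.2
    (fun u w w' => by rw [polar_comm, hp.1, polar_comm, p.polar_comm w'])
    (fun c u w => by rw [polar_comm, hp.2, polar_comm, smul_eq_mul])).toContinuousBilinearMap

theorem IsQuadratic.bilin_apply {p : Seminorm ℝ E} (hp : p.IsQuadratic) (u w : E) :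
    hp.bilin u w = p.polar u w := rfl

theorem isVonNBounded_sq_lt_one {p : Seminorm ℝ E} (hp : ∀ v, v ≠ 0 → 0 < p v) :
    Bornology.IsVonNBounded ℝ {v | p v ^ 2 < 1} := by
  -- A positive lower bound on the unit sphere, available also when the sphere is empty.
  obtain ⟨c, hc, hle⟩ := (isCompact_sphere (0 : E) 1).exists_forall_le'
    p.continuous_of_finiteDimensional.continuousOn
    (a := 0) fun v hv => hp v (ne_zero_of_mem_unit_sphere ⟨v, hv⟩)
  rw [NormedSpace.isVonNBounded_iff']
  refine ⟨c⁻¹, fun v hv => ?_⟩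
  rcases eq_or_ne v 0 with rfl | hv0
  · simpa using hc.le
  have hnv : 0 < ‖v‖ := norm_pos_iff.2 hv0
  have h1 := hle (‖v‖⁻¹ • v) (by simp [norm_smul, hnv.ne'])
  rw [map_smul_eq_mul, norm_inv, norm_norm, le_inv_mul_iff₀ hnv] at h1
  have h2 : p v < 1 := by
    have hv : p v ^ 2 < 1 := hv
    nlinarith [apply_nonneg p v]
  rw [le_inv_comm₀ hnv hc, ← one_div, le_div_iff₀ hnv]
  linarith

end Seminorm

namespace MinkowskiSpace

variable {p q : ℕ}

/-- The right side is bilinear; this is the source of the linearity of the polarized Finsler norm.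
-/
theorem quadForm_add_sub_quadForm_sub (a b : MinkowskiSpace p q) :
    (quadForm (a + b) - quadForm (a - b)) / 4 = inner ℝ a.1 b.1 - inner ℝ a.2 b.2 := by
  simp only [quadForm, Prod.fst_add, Prod.snd_add, Prod.fst_sub, Prod.snd_sub,
    norm_add_sq_real, norm_sub_sq_real]
  ring

end MinkowskiSpace

namespace FinslerStructure

variable {n : ℕ} {M : Type*} [TopologicalSpace M]
  [ChartedSpace (EuclideanSpace ℝ (Fin n)) M] [IsManifold (𝓡 n) 1 M]

/-- A Finsler structure whose norms are quadratic is Riemannian. -/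
theorem isRiemannian_of_isQuadratic (F : FinslerStructure n M)
    (hF : ∀ x, (F.norm x).IsQuadratic) : F.IsRiemannian := by
  let g : ∀ x : M, TangentSpace (𝓡 n) x →L[ℝ] TangentSpace (𝓡 n) x →L[ℝ] ℝ := fun x =>
    Seminorm.IsQuadratic.bilin (E := EuclideanSpace ℝ (Fin n)) (p := F.norm x) (hF x)
  have hg : ∀ x (u w : TangentSpace (𝓡 n) x), g x u w = (F.norm x).polar u w := fun x u w =>
    Seminorm.IsQuadratic.bilin_apply (E := EuclideanSpace ℝ (Fin n)) (p := F.norm x) (hF x) u w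
  have hgs : ∀ x (u : TangentSpace (𝓡 n) x), g x u u = F.norm x u ^ 2 := fun x u => by
    rw [hg, Seminorm.polar_self]
  refine ⟨⟨g, fun x u w => by rw [hg, hg, Seminorm.polar_comm], fun x u hu => ?_, fun x => ?_, ?_⟩,
    fun x v => (hgs x v).symm⟩
  · rw [hgs]
    exact pow_pos (F.pos x u hu) 2
  · simp only [hgs]
    exact Seminorm.isVonNBounded_sq_lt_one (E := EuclideanSpace ℝ (Fin n)) (p := F.norm x) (F.pos x)
  · refine continuous_iff_continuousAt.2 fun x₀ => ?_
    rw [continuousAt_hom_bundle]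
    refine ⟨continuousAt_id, ?_⟩
    have hsrc := (chartAt (EuclideanSpace ℝ (Fin n)) x₀).open_source.mem_nhds
      (mem_chart_source _ x₀)
    -- In finite dimension it suffices to test on fixed `u` and `w`, where the coordinates of `g`
    -- are the polarization of `localNorm`.
    refine continuousAt_clm_apply.2 fun u => continuousAt_clm_apply.2 fun w => ?_
    have hc : ContinuousAt (fun x => (F.localNorm x₀ x).polar u w) x₀ := by
      have h : ∀ v, ContinuousAt (fun x => F.localNorm x₀ x v) x₀ := fun v =>
        ContinuousAt.comp (x := x₀) (f := fun x => (x, v))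
          (g := fun z : M × EuclideanSpace ℝ (Fin n) => F.localNorm x₀ z.1 z.2)
          (F.continuousAt_localNorm (mem_chart_source _ x₀) v)
          (continuousAt_id.prodMk continuousAt_const)
      exact (((h _).pow 2).sub ((h _).pow 2)).div_const 4
    refine hc.congr ?_
    filter_upwards [hsrc] with x hx
    have hb : x ∈ (trivializationAt (EuclideanSpace ℝ (Fin n))
      (TangentSpace (𝓡 n) : M → Type _) x₀).baseSet := by simpa using hx
    rw [inCoordinates_apply_eq₂ hb hb (Set.mem_univ _), localNorm, Seminorm.polar_comp, hg,
      ContinuousLinearMap.coe_coe, Bundle.Trivialization.symmL_apply _ hb,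
      Bundle.Trivialization.symmL_apply _ hb]
    simp

end FinslerStructure

/-! ### From one Lipschitz projection to a Lipschitz map -/

theorem LipschitzOnWith.norm_sub_le_of_edist_le {X V : Type*} [PseudoEMetricSpace X]
    [NormedAddCommGroup V] {P : X → V} {L : ℝ≥0} {U : Set X} (hP : LipschitzOnWith L P U) {x y : X}
    (hx : x ∈ U) (hy : y ∈ U) {d : ℝ} (hd : 0 ≤ d) (h : edist x y ≤ ENNReal.ofReal d) :
    ‖P y - P x‖ ≤ L * d := by
  rw [← dist_eq_norm, dist_comm, ← edist_le_ofReal (by positivity)]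
  refine (hP hx hy).trans ?_
  rw [ENNReal.ofReal_mul L.coe_nonneg, ENNReal.ofReal_coe_nnreal]
  gcongr

/-- If one of the projections of a path is Lipschitz, then the energy bounds its increment. -/
theorem MinkowskiSpace.HasEnergy.norm_sub_le {p q : ℕ} {β : ℝ → MinkowskiSpace p q} {e L D : ℝ}
    (h : HasEnergy β 0 1 e) (hL : 0 ≤ L) (hD : 0 ≤ D) (he₀ : 0 ≤ e) (he : e ≤ D ^ 2)
    (hβ : (∀ s ∈ Icc (0 : ℝ) 1, ∀ t ∈ Icc (0 : ℝ) 1, s ≤ t →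
        ‖(β t).1 - (β s).1‖ ≤ L * D * (t - s)) ∨
      ∀ s ∈ Icc (0 : ℝ) 1, ∀ t ∈ Icc (0 : ℝ) 1, s ≤ t →
        ‖(β t).2 - (β s).2‖ ≤ L * D * (t - s)) :
    ‖β 1 - β 0‖ ≤ (L + 1) * D := by
  have hLD : L * D * (1 - 0) ≤ (L + 1) * D := by linarith
  -- Here `(L D)² + D² ≤ ((L + 1) D)²`. The first case below uses `0 ≤ e`, the second `e ≤ D²`.
  have hsq : ∀ {a : ℝ}, a ^ 2 ≤ (L * D) ^ 2 + D ^ 2 → a ≤ (L + 1) * D := fun ha =>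
    le_of_sq_le_sq (by linarith [mul_nonneg hL (sq_nonneg D)]) (by positivity)
  have zmem : (0 : ℝ) ∈ Icc (0 : ℝ) 1 := ⟨le_rfl, zero_le_one⟩
  have omem : (1 : ℝ) ∈ Icc (0 : ℝ) 1 := ⟨zero_le_one, le_rfl⟩
  rcases hβ with hβ | hβ
  · refine norm_prod_le_iff.2 ⟨(hβ 0 zmem 1 omem zero_le_one).trans hLD, hsq ?_⟩
    have h := h.norm_snd_sub_sq_le zero_lt_one hβ
    rw [sub_zero, div_one, mul_one] at h
    exact h.trans (by linarith [sq_nonneg D])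
  · refine norm_prod_le_iff.2 ⟨hsq ?_, (hβ 0 zmem 1 omem zero_le_one).trans hLD⟩
    have h := h.norm_fst_sub_sq_le zero_lt_one hβ
    rw [sub_zero, div_one, mul_one] at h
    exact h.trans (by linarith)

/-- If one projection of a path isometry is Lipschitz on a set, then the path isometry is Lipschitz
along the Lipschitz paths in this set. -/
theorem IsPathIsometry.norm_sub_le {X : Type*} [PseudoEMetricSpace X] {p q : ℕ}
    {f : X → MinkowskiSpace p q} (hiso : IsPathIsometry f) {L : ℝ≥0} {U : Set X}
    (hf : LipschitzOnWith L (MinkowskiSpace.posProj ∘ f) U ∨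
      LipschitzOnWith L (MinkowskiSpace.negProj ∘ f) U) {α : ℝ → X} {D : ℝ} (hD : 0 ≤ D)
    (hα : ∀ s ∈ Icc (0 : ℝ) 1, ∀ t ∈ Icc (0 : ℝ) 1, s ≤ t →
      edist (α s) (α t) ≤ ENNReal.ofReal (D * (t - s)))
    (hU : ∀ t ∈ Icc (0 : ℝ) 1, α t ∈ U) :
    ‖f (α 1) - f (α 0)‖ ≤ (L + 1) * D := by
  have he : (pathEnergy α 0 1).toReal ≤ D ^ 2 := by
    have h := ENNReal.toReal_mono ENNReal.ofReal_ne_top (pathEnergy_le_of_edist_le hD hα)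
    rwa [sub_zero, mul_one, ENNReal.toReal_ofReal (sq_nonneg D)] at h
  have hP : ∀ {m : ℕ} {P : X → EuclideanSpace ℝ (Fin m)}, LipschitzOnWith L P U →
      ∀ s ∈ Icc (0 : ℝ) 1, ∀ t ∈ Icc (0 : ℝ) 1, s ≤ t →
        ‖P (α t) - P (α s)‖ ≤ L * D * (t - s) := by
    intro m P hP s hs t ht hst
    rw [mul_assoc]
    exact hP.norm_sub_le_of_edist_le (hU s hs) (hU t ht)
      (mul_nonneg hD (sub_nonneg.2 hst)) (hα s hs t ht hst)
  have henergy := hiso α 0 1 zero_lt_one ⟨_, lipschitzOnWith_Icc_of_edist_le hD hα⟩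
  refine henergy.norm_sub_le L.coe_nonneg hD ENNReal.toReal_nonneg he ?_
  rcases hf with hf | hf
  · have h := hP hf
    exact Or.inl fun s hs t ht hst => h s hs t ht hst
  · have h := hP hf
    exact Or.inr fun s hs t ht hst => h s hs t ht hst

namespace FinslerStructure

variable {n : ℕ} {M : Type*} [EMetricSpace M]
  [ChartedSpace (EuclideanSpace ℝ (Fin n)) M] [IsManifold (𝓡 n) 1 M]

/-- A path isometry with one locally Lipschitz projection is locally Lipschitz in charts. -/
theorem exists_lipschitzOnWith_ball (F : FinslerStructure n M)
    (hdist : ∀ x y : M, edist x y = F.finslerEDist x y) {p q : ℕ} {f : M → MinkowskiSpace p q}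
    (hiso : IsPathIsometry f)
    (hf : LocallyLipschitz (MinkowskiSpace.posProj ∘ f) ∨
      LocallyLipschitz (MinkowskiSpace.negProj ∘ f)) (x₀ : M) :
    ∃ r > 0, Metric.ball (extChartAt (𝓡 n) x₀ x₀) r ⊆ (extChartAt (𝓡 n) x₀).target ∧
      ∃ K, LipschitzOnWith K (fun y => f ((extChartAt (𝓡 n) x₀).symm y))
        (Metric.ball (extChartAt (𝓡 n) x₀ x₀) r) := by
  obtain ⟨L, U, hU, hLU⟩ : ∃ (L : ℝ≥0), ∃ U ∈ 𝓝 x₀,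
      LipschitzOnWith L (MinkowskiSpace.posProj ∘ f) U ∨
        LipschitzOnWith L (MinkowskiSpace.negProj ∘ f) U := by
    rcases hf with hf | hf
    · obtain ⟨L, U, hU, h⟩ := hf x₀
      exact ⟨L, U, hU, Or.inl h⟩
    · obtain ⟨L, U, hU, h⟩ := hf x₀
      exact ⟨L, U, hU, Or.inr h⟩
  obtain ⟨r₁, hr₁, htgt, hball⟩ :=
    F.exists_ball_edist_le_localNorm hdist (mem_chart_source _ x₀) one_lt_two
  obtain ⟨r₂, hr₂, hsub⟩ := Metric.mem_nhds_iff.1 (extChartAt_preimage_mem_nhds (I := 𝓡 n) hU)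
  obtain ⟨B, hB, hbound⟩ := Seminorm.bound_of_continuous_normedSpace (F.localNorm x₀ x₀)
    (F.localNorm x₀ x₀).continuous_of_finiteDimensional
  have hs₁ := Metric.ball_subset_ball (x := extChartAt (𝓡 n) x₀ x₀) (min_le_left r₁ r₂)
  have hs₂ := Metric.ball_subset_ball (x := extChartAt (𝓡 n) x₀ x₀) (min_le_right r₁ r₂)
  refine ⟨min r₁ r₂, lt_min hr₁ hr₂, hs₁.trans htgt, _,
    LipschitzOnWith.of_dist_le' (K := (L + 1) * (2 * B)) fun z hz y hy => ?_⟩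
  have hmem : ∀ t ∈ Icc (0 : ℝ) 1, y + t • (z - y) ∈
      Metric.ball (extChartAt (𝓡 n) x₀ x₀) (min r₁ r₂) := fun t ht =>
    (convex_ball _ _).add_smul_sub_mem hy hz ht
  set α : ℝ → M := fun t => (extChartAt (𝓡 n) x₀).symm (y + t • (z - y)) with hα
  -- A speed bound for the segment in `M`: `2` compares the distance with the norm at `x₀`, and `B`
  -- compares that norm with the Euclidean one.
  set D : ℝ := 2 * B * ‖z - y‖ with hD
  have hD0 : 0 ≤ D := by positivity
  have hed : ∀ s ∈ Icc (0 : ℝ) 1, ∀ t ∈ Icc (0 : ℝ) 1, s ≤ t →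
      edist (α s) (α t) ≤ ENNReal.ofReal (D * (t - s)) := by
    intro s hs t ht hst
    refine (hball _ (hs₁ (hmem s hs)) _ (hs₁ (hmem t ht))).trans (ENNReal.ofReal_le_ofReal ?_)
    rw [add_sub_add_left_eq_sub, ← sub_smul, map_smul_eq_mul,
      Real.norm_of_nonneg (sub_nonneg.2 hst)]
    nlinarith [mul_le_mul_of_nonneg_left (hbound (z - y)) (sub_nonneg.2 hst)]
  have h := hiso.norm_sub_le hLU hD0 hed fun t ht => hsub (hs₂ (hmem t ht))
  have h0 : α 0 = (extChartAt (𝓡 n) x₀).symm y := by simp [hα]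
  have h1 : α 1 = (extChartAt (𝓡 n) x₀).symm z := by simp [hα]
  rw [h0, h1] at h
  rwa [dist_eq_norm z y, mul_assoc, ← hD, dist_eq_norm]

theorem continuousOn_localNorm_extChartAt_symm (F : FinslerStructure n M) (x₀ : M)
    (v : EuclideanSpace ℝ (Fin n)) :
    ContinuousOn (fun y => F.localNorm x₀ ((extChartAt (𝓡 n) x₀).symm y) v)
      (extChartAt (𝓡 n) x₀).target := by
  refine ContinuousOn.comp (g := fun z : M × EuclideanSpace ℝ (Fin n) => F.localNorm x₀ z.1 z.2)
    (F.continuousOn_localNorm x₀)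
    ((continuousOn_extChartAt_symm x₀).prodMk continuousOn_const) fun y hy => ⟨?_, mem_univ _⟩
  rw [← extChartAt_source (𝓡 n)]
  exact (extChartAt (𝓡 n) x₀).map_target hy

/-! ### Quadraticity of the norms and conclusion -/

/-- The norms of a Finsler manifold with a path isometry to Minkowski space, one projection of
which is locally Lipschitz, are quadratic. -/
theorem isQuadratic_norm (F : FinslerStructure n M)
    (hdist : ∀ x y : M, edist x y = F.finslerEDist x y) {p q : ℕ} {f : M → MinkowskiSpace p q}
    (hiso : IsPathIsometry f)
    (hf : LocallyLipschitz (MinkowskiSpace.posProj ∘ f) ∨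
      LocallyLipschitz (MinkowskiSpace.negProj ∘ f)) (x₀ : M) :
    (F.norm x₀).IsQuadratic := by
  obtain ⟨r, hr, htgt, K, hK⟩ := F.exists_lipschitzOnWith_ball hdist hiso hf x₀
  obtain ⟨G, hG, hfG⟩ := hK.extend_finite_dimension
  set s := Metric.ball (extChartAt (𝓡 n) x₀ x₀) r with hs
  have hsopen : IsOpen s := Metric.isOpen_ball
  set N : EuclideanSpace ℝ (Fin n) → Seminorm ℝ (EuclideanSpace ℝ (Fin n)) :=
    fun y => F.localNorm x₀ ((extChartAt (𝓡 n) x₀).symm y) with hN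
  have hcont : ∀ v, ContinuousOn (fun y => N y v) s := fun v =>
    (F.continuousOn_localNorm_extChartAt_symm x₀ v).mono htgt
  -- The null set depends on `v`, so linearity is checked one choice of vectors at a time.
  have hae : ∀ v, ∀ᵐ y, y ∈ s → N y v ^ 2 = MinkowskiSpace.quadForm (fderiv ℝ G y v) := by
    intro v
    refine MinkowskiSpace.ae_eq_quadForm_fderiv MeasureTheory.volume hG hsopen
      ((hcont v).pow 2) v fun y t hyt => ⟨_, ?_, F.tendsto_pathEnergy_line_div hdist x₀ (htgt hyt)⟩
    have hline : ContinuousAt (fun t : ℝ => y + t • v) t := by fun_prop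
    obtain ⟨δ, hδ, hsub⟩ := Metric.mem_nhds_iff.1
      (hline.preimage_mem_nhds (hsopen.mem_nhds hyt))
    filter_upwards [F.eventually_hasEnergy_line hdist hiso x₀ (htgt hyt), Ioo_mem_nhdsGT hδ]
      with h hh hhδ
    refine hh.congr (by linarith [hhδ.1]) fun u hu => hfG (hsub (a := u) ?_)
    rw [Metric.mem_ball, Real.dist_eq, abs_of_nonneg (sub_nonneg.2 hu.1)]
    linarith [hu.2, hhδ.2]
  have haepolar : ∀ u w, ∀ᵐ y, y ∈ s → (N y).polar u w =
      inner ℝ (fderiv ℝ G y u).1 (fderiv ℝ G y w).1 -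
        inner ℝ (fderiv ℝ G y u).2 (fderiv ℝ G y w).2 := by
    intro u w
    filter_upwards [hae (u + w), hae (u - w)] with y h1 h2 hy
    rw [Seminorm.polar, h1 hy, h2 hy, map_add, map_sub,
      MinkowskiSpace.quadForm_add_sub_quadForm_sub]
  have hcpolar : ∀ u w, ContinuousOn (fun y => (N y).polar u w) s := fun u w =>
    (((hcont _).pow 2).sub ((hcont _).pow 2)).div_const 4
  have hmem : extChartAt (𝓡 n) x₀ x₀ ∈ s := Metric.mem_ball_self hr
  -- `G` need not be differentiable at the centre; continuity carries the almost everywhere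
  -- relations there.
  have heq : ∀ {g h : EuclideanSpace ℝ (Fin n) → ℝ}, (∀ᵐ y, y ∈ s → g y = h y) →
      ContinuousOn g s → ContinuousOn h s →
        g (extChartAt (𝓡 n) x₀ x₀) = h (extChartAt (𝓡 n) x₀ x₀) := fun hgh hg hh =>
    MeasureTheory.Measure.eqOn_open_of_ae_eq
      ((MeasureTheory.ae_restrict_iff' hsopen.measurableSet).2 hgh) hsopen hg hh hmem
  have hquad : (F.localNorm x₀ x₀).IsQuadratic := by
    have hN0 : F.localNorm x₀ x₀ = N (extChartAt (𝓡 n) x₀ x₀) := by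
      simp only [hN, extChartAt_to_inv]
    rw [hN0]
    refine ⟨fun u u' w => ?_, fun c u w => ?_⟩
    · refine heq (g := fun y => (N y).polar (u + u') w)
        (h := fun y => (N y).polar u w + (N y).polar u' w) ?_ (hcpolar _ _)
        ((hcpolar _ _).add (hcpolar _ _))
      filter_upwards [haepolar (u + u') w, haepolar u w, haepolar u' w] with y h1 h2 h3 hy
      rw [h1 hy, h2 hy, h3 hy, map_add, Prod.fst_add, Prod.snd_add, inner_add_left,
        inner_add_left]
      ring
    · refine heq (g := fun y => (N y).polar (c • u) w) (h := fun y => c * (N y).polar u w) ?_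
        (hcpolar _ _) (continuousOn_const.mul (hcpolar _ _))
      filter_upwards [haepolar (c • u) w, haepolar u w] with y h1 h2 hy
      rw [h1 hy, h2 hy, map_smul, Prod.smul_fst, Prod.smul_snd, real_inner_smul_left,
        real_inner_smul_left]
      ring
  have hnorm : F.norm x₀ = (F.localNorm x₀ x₀).comp ((trivializationAt
      (EuclideanSpace ℝ (Fin n)) (TangentSpace (𝓡 n) : M → Type _) x₀).continuousLinearMapAt ℝ
        x₀).toLinearMap :=
    Seminorm.ext fun v => (F.localNorm_continuousLinearMapAt (mem_chart_source _ x₀) v).symm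
  rw [hnorm]
  exact hquad.comp _

end FinslerStructure

theorem mainTheorem4 (n : ℕ) {M : Type*} [EMetricSpace M]
    [ChartedSpace (EuclideanSpace ℝ (Fin n)) M] [IsManifold (𝓡 n) 1 M]
    (F : FinslerStructure n M) (hdist : ∀ x y : M, edist x y = F.finslerEDist x y)
    (hF : ¬ F.IsRiemannian)
    (p q : ℕ) (f : M → MinkowskiSpace p q)
    (hemb : IsEmbedding f) (hiso : IsPathIsometry f) :
    0 < p ∧ 0 < q ∧
      ¬ LocallyLipschitz (MinkowskiSpace.posProj ∘ f) ∧
      ¬ LocallyLipschitz (MinkowskiSpace.negProj ∘ f) := by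
  have key : ¬ (LocallyLipschitz (MinkowskiSpace.posProj ∘ f) ∨
      LocallyLipschitz (MinkowskiSpace.negProj ∘ f)) := fun h =>
    hF (F.isRiemannian_of_isQuadratic (F.isQuadratic_norm hdist hiso h))
  rw [not_or] at key
  refine ⟨Nat.pos_of_ne_zero ?_, Nat.pos_of_ne_zero ?_, key⟩
  · rintro rfl
    refine key.1 ?_
    rw [Subsingleton.elim (MinkowskiSpace.posProj ∘ f) fun _ => 0]
    exact LocallyLipschitz.const 0
  · rintro rfl
    refine key.2 ?_
    rw [Subsingleton.elim (MinkowskiSpace.negProj ∘ f) fun _ => 0]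
    exact LocallyLipschitz.const 0
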